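/- **Theorem 2 (Asymptotic normality).** Let $(X,Y)$ be a random vector with law $\mathbb P$ on $\{a_1,\dots,a_r\}\times\{0,1\}$, and put $p_j=\mathbb P(X=a_j\mid Y=1)$, $q_j=\mathbb P(X=a_j\mid Y=0)$. Assume $p_j>0$ and $q_j>0$ for all $j$, and $\mathbf p\neq\mathbf q$. Let $J(\mathbf p,\mathbf q)=\sum_{j=1}^r(p_j-q_j)\ln\frac{p_j}{q_j}$ be the Jeffreys divergence. Let $(X_1,Y_1),(X_2,Y_2),\dots$ be i.i.d. with law $\mathbb P$; among the first $N$ of them let $n$ be the number with $Y_i=1$ and $m=N-n$ the number with $Y_i=0$, and let $\hat{\mathbf p}_n,\hat{\mathbf q}_m$ be the empirical distributions $$\hat p_n^{\,a_j}=\frac1n\sum_{i=1}^N \mathbf I[(X_i,Y_i)=(a_j,1)],\qquad \hat q_m^{\,a_j}=\frac1m\sum_{i=1}^N \mathbf I[(X_i,Y_i)=(a_j,0)].$$ Define $$V_1(\mathbf p,\mathbf q)=\sum_{j}p_j(1-p_j)\Big(1+\ln\tfrac{p_j}{q_j}-\tfrac{q_j}{p_j}\Big)^2-2\sum_{i<j}p_ip_j\Big(1+\ln\tfrac{p_i}{q_i}-\tfrac{q_i}{p_i}\Big)\Big(1+\ln\tfrac{p_j}{q_j}-\tfrac{q_j}{p_j}\Big),$$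 $$V_2(\mathbf p,\mathbf q)=\sum_{j}q_j(1-q_j)\Big(1+\ln\tfrac{q_j}{p_j}-\tfrac{p_j}{q_j}\Big)^2-2\sum_{i<j}q_iq_j\Big(1+\ln\tfrac{q_i}{p_i}-\tfrac{p_i}{q_i}\Big)\Big(1+\ln\tfrac{q_j}{p_j}-\tfrac{p_j}{q_j}\Big).$$ Then $$\bigg(\frac{nm}{m\,V_1(\mathbf p,\mathbf q)+n\,V_2(\mathbf p,\mathbf q)}\bigg)^{1/2}\Big(J(\hat{\mathbf p}_n,\hat{\mathbf q}_m)-J(\mathbf p,\mathbf q)\Big)\overset{d}{\Longrightarrow}\mathcal N(0,1)$$ in both of the following senses: (i) as the sample size $N\to\infty$, with $n$ and $m$ the random class sizes; (ii) as $(n,m)\to(\infty,\infty)$ in any way, for given class sizes $n$ and $m$, that is, under the conditional law given that exactly $n$ of the first $N=n+m$ labels equal $1$ (an event of positive probability). -/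

import Mathlib

open MeasureTheory ProbabilityTheory Filter Topology

noncomputable section

/-- The distribution of the bin given the label `y`: the vector of the conditional
probabilities `P(X = j | Y = y)`, for the joint law `P` of `(X, Y)` on bins times labels. -/
def condBin {r : ℕ} (P : Measure (Fin r × Fin 2)) (y : Fin 2) (j : Fin r) : ℝ :=
  (ProbabilityTheory.cond P {z | z.2 = y}).real {z | z.1 = j}

/-- The Jeffreys divergence `J(p, q)`. -/
def jeffreys {r : ℕ} (p q : Fin r → ℝ) : ℝ :=
  ∑ j, (p j - q j) * Real.log (p j / q j)

/-- The number of observations equal to `(j, y)` among the first `N` observations of `z`. -/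
def binCount {r : ℕ} (z : ℕ → Fin r × Fin 2) (N : ℕ) (y : Fin 2) (j : Fin r) : ℕ :=
  ∑ i ∈ Finset.range N, if z i = (j, y) then 1 else 0

/-- The number of observations with label `y` among the first `N` observations of `z`
(`n` for the label `1` and `m` for the label `0`). -/
def labelCount {r : ℕ} (z : ℕ → Fin r × Fin 2) (N : ℕ) (y : Fin 2) : ℕ :=
  ∑ j, binCount z N y j

/-- `m = N - n`. -/
theorem labelCount_zero_eq {r : ℕ} (z : ℕ → Fin r × Fin 2) (N : ℕ) :
    labelCount z N 0 = N - labelCount z N 1 := by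
  have key : ∀ y, labelCount z N y =
      ∑ i ∈ Finset.range N, if (z i).2 = y then 1 else 0 := by
    intro y
    unfold labelCount binCount
    rw [Finset.sum_comm]
    refine Finset.sum_congr rfl fun i _ => ?_
    by_cases h : (z i).2 = y <;> simp [Prod.ext_iff, h]
  have h : labelCount z N 0 + labelCount z N 1 = N := by
    rw [key, key, ← Finset.sum_add_distrib]
    have h1 : ∀ i ∈ Finset.range N, ((if (z i).2 = 0 then 1 else 0) +
        (if (z i).2 = 1 then 1 else 0) : ℕ) = 1 := by
      intro i _
      generalize (z i).2 = y
      fin_cases y <;> simp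
    rw [Finset.sum_congr rfl h1]
    simp
  omega

/-- The empirical distribution of the bins among those of the first `N` observations that
carry the label `y` (`p̂ₙ` for the label `1` and `q̂ₘ` for the label `0`). -/
def empBin {r : ℕ} (z : ℕ → Fin r × Fin 2) (N : ℕ) (y : Fin 2) (j : Fin r) : ℝ :=
  (binCount z N y j : ℝ) / (labelCount z N y : ℝ)

/-- The variance functional attached to the sample of label `1`. The bracket is the partial
derivative of `(x - y) log (x / y)` with respect to `x` at `(p j, q j)`. -/
def V₁ {r : ℕ} (p q : Fin r → ℝ) : ℝ :=
  ∑ j, p j * (1 - p j) * (1 + Real.log (p j / q j) - q j / p j) ^ 2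
    - 2 * ∑ ij : Fin r × Fin r with ij.1 < ij.2,
        p ij.1 * p ij.2 * (1 + Real.log (p ij.1 / q ij.1) - q ij.1 / p ij.1)
          * (1 + Real.log (p ij.2 / q ij.2) - q ij.2 / p ij.2)

/-- The variance functional attached to the sample of label `0`. The bracket is the partial
derivative of `(x - y) log (x / y)` with respect to `y` at `(p j, q j)`. -/
def V₂ {r : ℕ} (p q : Fin r → ℝ) : ℝ :=
  ∑ j, q j * (1 - q j) * (1 + Real.log (q j / p j) - p j / q j) ^ 2
    - 2 * ∑ ij : Fin r × Fin r with ij.1 < ij.2,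
        q ij.1 * q ij.2 * (1 + Real.log (q ij.1 / p ij.1) - p ij.1 / q ij.1)
          * (1 + Real.log (q ij.2 / p ij.2) - p ij.2 / q ij.2)

/-- The normalized error
`(n m / (m V₁(p, q) + n V₂(p, q)))^(1/2) (J(p̂ₙ, q̂ₘ) - J(p, q))`
computed from the first `N` observations of `z`. -/
def normError {r : ℕ} (p q : Fin r → ℝ) (z : ℕ → Fin r × Fin 2) (N : ℕ) : ℝ :=
  let n : ℝ := labelCount z N 1
  let m : ℝ := labelCount z N 0
  Real.sqrt (n * m / (m * V₁ p q + n * V₂ p q)) *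
    (jeffreys (empBin z N 1) (empBin z N 0) - jeffreys p q)

end

/-!
Everything goes through characteristic functions. Expanding according to the set of indices that
carry the label `1` gives the exact formula `integral_cond_prod`: given that `n` of the first
`n + m` labels are `1`, the expectation of `∏ i, h (Z i)` is `(∑ j, p j h(j, 1)) ^ n *
(∑ j, q j h(j, 0)) ^ m`. All facts about the conditional law are instances of it.

* With `h` an exponential of a centered indicator, a Chernoff bound shows that the empirical
  frequencies deviate from `p` and `q` by `O(1 / √n)` and `O(1 / √m)` in conditional probability
  (`measureReal_cond_empBin_le`). Since the Jeffreys divergence is differentiable at `(p, q)`, the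
  normalized error differs from its linearization by a term that tends to `0` in conditional
  probability (`eventually_measureReal_cond_normError_sub_le`). The empirical distributions with
  vanishing entries, where the logarithms take junk values, lie in the exceptional event.
* With `h` a complex exponential, the conditional characteristic function of the linearization is
  `φ(t c / n) ^ n * ψ(t c / m) ^ m`, with `φ` and `ψ` the characteristic functions of the centered
  slopes, whose variances are `V₁` and `V₂` (`V₁_eq_variance`). Here `n (c / n)² V₁ + m (c / m)² V₂`
  is exactly `1`, and a second-order expansion with `‖a ^ n - b ^ n‖ ≤ n ‖a - b‖` gives the limit
  `exp (-t² / 2)` without any assumption on the ratio of `n` and `m`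
  (`tendsto_weightedCharFun_pow_mul`). Positivity of `V₁` and `V₂` comes from `p ≠ q` (`V₁_pos`).

Lévy's theorem then gives the conditional statement. The unconditional characteristic function is
the average of the conditional ones over the random class sizes
(`integral_eq_integral_cond_labelCount`), and the probability that a class has fewer than `n₀`
elements tends to `0` (`tendsto_measureReal_labelCount_lt`), which gives the unconditional
statement.
-/

/-! ### Conditioning on the label counts -/

section Counts

variable {r : ℕ}

theorem labelCount_eq_card (z : ℕ → Fin r × Fin 2) (N : ℕ) (y : Fin 2) :
    labelCount z N y = ((Finset.range N).filter fun i => (z i).2 = y).card := by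
  unfold labelCount binCount
  rw [Finset.sum_comm, Finset.card_filter]
  refine Finset.sum_congr rfl fun i _ => ?_
  by_cases h : (z i).2 = y <;> simp [Prod.ext_iff, h]

theorem labelCount_add (z : ℕ → Fin r × Fin 2) (N : ℕ) :
    labelCount z N 1 + labelCount z N 0 = N := by
  have h : labelCount z N 1 ≤ N := by
    rw [labelCount_eq_card]
    exact (Finset.card_filter_le _ _).trans_eq (Finset.card_range N)
  rw [labelCount_zero_eq]
  omega

/-- A sum over the observations is the sum over the cells weighted by the cell counts. -/
theorem sum_binCount_mul {R : Type*} [CommSemiring R] (z : ℕ → Fin r × Fin 2) (N : ℕ)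
    (y : Fin 2) (h : Fin r → R) :
    ∑ j, (binCount z N y j : R) * h j =
      ∑ i ∈ Finset.range N, if (z i).2 = y then h (z i).1 else 0 := by
  simp only [binCount, Nat.cast_sum, Finset.sum_mul]
  rw [Finset.sum_comm]
  refine Finset.sum_congr rfl fun i _ => ?_
  by_cases hy : (z i).2 = y <;> simp [Prod.ext_iff, hy]

/-- A product over the observations, restricted to the event that exactly `n` labels are `1`,
split according to the set `S` of the indices that carry the label `1`. -/
theorem ite_labelCount_prod_eq {R : Type*} [CommSemiring R] (z : ℕ → Fin r × Fin 2) (N n : ℕ)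
    (h : Fin r × Fin 2 → R) :
    (if labelCount z N 1 = n then ∏ i ∈ Finset.range N, h (z i) else 0) =
      ∑ S ∈ (Finset.range N).powersetCard n, ∏ i ∈ Finset.range N,
        if (z i).2 = (if i ∈ S then 1 else 0) then h (z i) else 0 := by
  set T := (Finset.range N).filter fun i => (z i).2 = 1 with hT
  have hne : ∀ S ∈ (Finset.range N).powersetCard n, S ≠ T →
      ∏ i ∈ Finset.range N, (if (z i).2 = (if i ∈ S then 1 else 0) then h (z i) else 0) = 0 := by
    intro S hS hST
    have hSN := (Finset.mem_powersetCard.1 hS).1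
    obtain ⟨i, hi⟩ : ∃ i, ¬ (i ∈ S ↔ i ∈ T) := by
      by_contra! H
      exact hST (Finset.ext H)
    have hiN : i ∈ Finset.range N := by
      by_contra hiN
      exact hi ⟨fun h => absurd (hSN h) hiN, fun h => absurd (Finset.mem_filter.1 h).1 hiN⟩
    refine Finset.prod_eq_zero hiN (if_neg fun hz => hi ?_)
    rw [hT, Finset.mem_filter, and_iff_right hiN, hz]
    split_ifs with hiS <;> simp [hiS]
  rw [labelCount_eq_card, ← hT]
  split_ifs with hc
  · have hTm : T ∈ (Finset.range N).powersetCard n :=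
      Finset.mem_powersetCard.2 ⟨Finset.filter_subset _ _, hc⟩
    rw [Finset.sum_eq_single_of_mem T hTm hne]
    refine Finset.prod_congr rfl fun i hi => (if_pos ?_).symm
    have : i ∈ T ↔ (z i).2 = 1 := by rw [hT, Finset.mem_filter, and_iff_right hi]
    split_ifs with h1
    · exact this.1 h1
    · have := mt this.2 h1
      generalize (z i).2 = y at this
      fin_cases y
      · rfl
      · exact absurd rfl this
  · refine (Finset.sum_eq_zero fun S hS => hne S hS ?_).symm
    rintro rfl
    exact hc (Finset.mem_powersetCard.1 hS).2

end Counts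

section Law

variable {r : ℕ} {P : Measure (Fin r × Fin 2)} [IsProbabilityMeasure P]
  {Ω : Type*} [MeasurableSpace Ω] {μ : Measure Ω} {Z : ℕ → Ω → Fin r × Fin 2}

/-- The product formula `P(X = j, Y = y) = P(Y = y) P(X = j | Y = y)`. It needs no positivity: if
`P(Y = y) = 0`, both sides vanish. -/
theorem real_singleton_eq_mul_condBin (j : Fin r) (y : Fin 2) :
    P.real {(j, y)} = P.real {z | z.2 = y} * condBin P y j := by
  have hm : MeasurableSet {z : Fin r × Fin 2 | z.2 = y} := .of_discrete
  have hset : ({z | z.2 = y} : Set (Fin r × Fin 2)) ∩ {z | z.1 = j} = {(j, y)} := by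
    ext z
    simp [Prod.ext_iff, and_comm]
  have hle : P {(j, y)} ≤ P {z | z.2 = y} := measure_mono (by rintro z rfl; rfl)
  rw [condBin, measureReal_def, measureReal_def, measureReal_def, cond_apply hm, hset,
    ← ENNReal.toReal_mul, ← mul_assoc]
  rcases eq_or_ne (P {z | z.2 = y}) 0 with h0 | h0
  · rw [h0] at hle ⊢
    simp [le_antisymm hle zero_le]
  · rw [ENNReal.mul_inv_cancel h0 (measure_ne_top _ _), one_mul]

theorem real_label_pos_of_condBin_pos {y : Fin 2} {j : Fin r} (h : 0 < condBin P y j) :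
    0 < P.real {z | z.2 = y} := by
  rw [measureReal_nonneg.lt_iff_ne]
  intro h0
  have h1 : P {z | z.2 = y} = 0 := ((measureReal_eq_zero_iff (measure_ne_top _ _)).1 h0.symm)
  rw [condBin, cond_eq_zero_of_meas_eq_zero h1] at h
  simp at h

theorem sum_condBin {y : Fin 2} (h : 0 < P.real {z | z.2 = y}) : ∑ j, condBin P y j = 1 := by
  have h0 : P {z | z.2 = y} ≠ 0 := fun h0 => by simp [measureReal_def, h0] at h
  have := cond_isProbabilityMeasure h0
  have hfib := sum_measureReal_preimage_singleton (μ := P[|{z | z.2 = y}])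
    (Finset.univ : Finset (Fin r)) (f := Prod.fst) (fun _ _ => .of_discrete)
  calc ∑ j, condBin P y j = P[|{z | z.2 = y}].real (Prod.fst ⁻¹' (Finset.univ : Finset (Fin r))) :=
        hfib
    _ = 1 := by simp

/-- The expectation of a function of one observation on the event that its label is `y`. -/
theorem integral_comp_label {𝕜 : Type*} [RCLike 𝕜] (hZ_meas : ∀ i, Measurable (Z i))
    (hZ_law : ∀ i, μ.map (Z i) = P) (h : Fin r × Fin 2 → 𝕜) (y : Fin 2) (i : ℕ) :
    ∫ ω, (if (Z i ω).2 = y then h (Z i ω) else 0) ∂μ =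
      (P.real {z | z.2 = y} : 𝕜) * ∑ j, (condBin P y j : 𝕜) * h (j, y) := by
  have := integral_map (μ := μ) (hZ_meas i).aemeasurable
    (f := fun z => if z.2 = y then h z else 0)
    (measurable_of_countable _).aestronglyMeasurable
  rw [← this, hZ_law, integral_fintype .of_finite, Fintype.sum_prod_type, Finset.mul_sum]
  refine Finset.sum_congr rfl fun j _ => ?_
  rw [Finset.sum_eq_single y (by rintro b - hb; simp [hb]) (by simp)]
  simp only [if_true, real_singleton_eq_mul_condBin, RCLike.real_smul_eq_coe_mul]
  push_cast
  ring

theorem integral_prod_range {𝕜 : Type*} [RCLike 𝕜] (hZ_meas : ∀ i, Measurable (Z i))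
    (hZ_indep : iIndepFun Z μ) (N : ℕ) (g : ℕ → Fin r × Fin 2 → 𝕜) :
    ∫ ω, ∏ i ∈ Finset.range N, g i (Z i ω) ∂μ =
      ∏ i ∈ Finset.range N, ∫ ω, g i (Z i ω) ∂μ := by
  have h := iIndepFun.integral_fun_prod_comp (X := fun i : Fin N => Z i)
    (hZ_indep.precomp Fin.val_injective)
    (fun i => (hZ_meas i).aemeasurable) (f := fun i => g i)
    (fun i => (measurable_of_countable _).aestronglyMeasurable)
  simp only [Finset.prod_range]
  exact h

theorem integrable_comp_finite [IsProbabilityMeasure μ] {𝕜 : Type*} [RCLike 𝕜]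
    (hZ_meas : ∀ i, Measurable (Z i)) (N : ℕ)
    (g : (Fin N → Fin r × Fin 2) → 𝕜) : Integrable (fun ω => g fun i => Z i ω) μ := by
  have hm : Measurable fun ω => fun i : Fin N => Z i ω :=
    measurable_pi_lambda _ fun i => hZ_meas i
  have := Measure.isProbabilityMeasure_map (μ := μ) hm.aemeasurable
  exact (Integrable.of_finite (μ := μ.map _) (f := g)).comp_measurable hm

theorem measurable_labelCount (hZ_meas : ∀ i, Measurable (Z i)) (N : ℕ) (y : Fin 2) :
    Measurable fun ω => labelCount (fun i => Z i ω) N y := by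
  unfold labelCount binCount
  refine Finset.measurable_fun_sum _ fun j _ => Finset.measurable_fun_sum _ fun i _ => ?_
  exact (measurable_of_countable fun z : Fin r × Fin 2 => if z = (j, y) then 1 else 0).comp
    (hZ_meas i)

theorem measurableSet_labelCount_eq (hZ_meas : ∀ i, Measurable (Z i)) (N n : ℕ) (y : Fin 2) :
    MeasurableSet {ω | labelCount (fun i => Z i ω) N y = n} :=
  measurable_labelCount hZ_meas N y (measurableSet_singleton n)

/-- Expand over the set of indices labelled `1`; by independence each of the `(n + m).choose n`
sets of size `n` contributes the same product. -/
theorem setIntegral_labelCount_prod [IsProbabilityMeasure μ] {𝕜 : Type*} [RCLike 𝕜]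
    (hZ_meas : ∀ i, Measurable (Z i)) (hZ_indep : iIndepFun Z μ)
    (hZ_law : ∀ i, μ.map (Z i) = P) (n m : ℕ) (h : Fin r × Fin 2 → 𝕜) :
    ∫ ω in {ω | labelCount (fun i => Z i ω) (n + m) 1 = n},
        ∏ i ∈ Finset.range (n + m), h (Z i ω) ∂μ =
      ((n + m).choose n * (P.real {z | z.2 = 1}) ^ n * (P.real {z | z.2 = 0}) ^ m : ℝ) *
        ((∑ j, (condBin P 1 j : 𝕜) * h (j, 1)) ^ n * (∑ j, (condBin P 0 j : 𝕜) * h (j, 0)) ^ m) := by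
  rw [← integral_indicator (measurableSet_labelCount_eq hZ_meas _ _ _)]
  have hpt : ∀ ω, Set.indicator {ω | labelCount (fun i => Z i ω) (n + m) 1 = n}
      (fun ω => ∏ i ∈ Finset.range (n + m), h (Z i ω)) ω =
      ∑ S ∈ (Finset.range (n + m)).powersetCard n, ∏ i ∈ Finset.range (n + m),
        if (Z i ω).2 = (if i ∈ S then 1 else 0) then h (Z i ω) else 0 := fun ω => by
    rw [← ite_labelCount_prod_eq (fun i => Z i ω), Set.indicator_apply]
    rfl
  simp only [hpt]
  rw [integral_finsetSum]
  · have hS : ∀ S ∈ (Finset.range (n + m)).powersetCard n,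
        ∫ ω, ∏ i ∈ Finset.range (n + m),
          (if (Z i ω).2 = (if i ∈ S then 1 else 0) then h (Z i ω) else 0) ∂μ =
        (((P.real {z | z.2 = 1} : ℝ) : 𝕜) * ∑ j, (condBin P 1 j : 𝕜) * h (j, 1)) ^ n *
        (((P.real {z | z.2 = 0} : ℝ) : 𝕜) * ∑ j, (condBin P 0 j : 𝕜) * h (j, 0)) ^ m := by
      intro S hS
      obtain ⟨hSN, hSc⟩ := Finset.mem_powersetCard.1 hS
      rw [integral_prod_range hZ_meas hZ_indep (n + m)
        (fun i z => if z.2 = (if i ∈ S then 1 else 0) then h z else 0)]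
      have hi : ∀ i ∈ Finset.range (n + m),
          ∫ ω, (if (Z i ω).2 = (if i ∈ S then 1 else 0) then h (Z i ω) else 0) ∂μ =
          if i ∈ S then ((P.real {z | z.2 = 1} : ℝ) : 𝕜) * ∑ j, (condBin P 1 j : 𝕜) * h (j, 1)
          else ((P.real {z | z.2 = 0} : ℝ) : 𝕜) * ∑ j, (condBin P 0 j : 𝕜) * h (j, 0) := by
        intro i _
        rw [integral_comp_label hZ_meas hZ_law]
        split_ifs <;> rfl
      rw [Finset.prod_congr rfl hi, Finset.prod_ite, Finset.prod_const, Finset.prod_const,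
        Finset.filter_mem_eq_inter, Finset.inter_eq_right.2 hSN, hSc, Finset.filter_notMem_eq_sdiff,
        Finset.card_sdiff_of_subset hSN, hSc, Finset.card_range, Nat.add_sub_cancel_left]
    rw [Finset.sum_congr rfl hS, Finset.sum_const, Finset.card_powersetCard, Finset.card_range]
    simp only [nsmul_eq_mul]
    push_cast
    ring
  · intro S _
    refine (integrable_comp_finite hZ_meas (n + m) (fun z => ∏ i : Fin (n + m),
      if (z i).2 = (if (i : ℕ) ∈ S then 1 else 0) then h (z i) else 0)).congr (ae_of_all _ fun ω => ?_)
    simp only [Finset.prod_range]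

theorem measureReal_labelCount_eq [IsProbabilityMeasure μ]
    (hZ_meas : ∀ i, Measurable (Z i)) (hZ_indep : iIndepFun Z μ)
    (hZ_law : ∀ i, μ.map (Z i) = P)
    (h1 : 0 < P.real {z | z.2 = 1}) (h0 : 0 < P.real {z | z.2 = 0}) (n m : ℕ) :
    μ.real {ω | labelCount (fun i => Z i ω) (n + m) 1 = n} =
      (n + m).choose n * (P.real {z | z.2 = 1}) ^ n * (P.real {z | z.2 = 0}) ^ m := by
  have := setIntegral_labelCount_prod (𝕜 := ℝ) hZ_meas hZ_indep hZ_law n m fun _ => 1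
  simpa [sum_condBin h1, sum_condBin h0] using this

theorem measureReal_labelCount_eq_pos [IsProbabilityMeasure μ]
    (hZ_meas : ∀ i, Measurable (Z i)) (hZ_indep : iIndepFun Z μ)
    (hZ_law : ∀ i, μ.map (Z i) = P)
    (h1 : 0 < P.real {z | z.2 = 1}) (h0 : 0 < P.real {z | z.2 = 0}) (n m : ℕ) :
    0 < μ.real {ω | labelCount (fun i => Z i ω) (n + m) 1 = n} := by
  rw [measureReal_labelCount_eq hZ_meas hZ_indep hZ_law h1 h0]
  have : 0 < (n + m).choose n := Nat.choose_pos (Nat.le_add_right n m)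
  positivity

/-- Given the class sizes `n` and `m`, a product over the observations has the expectation it would
have for two independent i.i.d. samples of sizes `n` and `m` from the two conditional laws. -/
theorem integral_cond_prod [IsProbabilityMeasure μ] {𝕜 : Type*} [RCLike 𝕜]
    (hZ_meas : ∀ i, Measurable (Z i)) (hZ_indep : iIndepFun Z μ)
    (hZ_law : ∀ i, μ.map (Z i) = P)
    (h1 : 0 < P.real {z | z.2 = 1}) (h0 : 0 < P.real {z | z.2 = 0}) (n m : ℕ)
    (h : Fin r × Fin 2 → 𝕜) :
    ∫ ω, ∏ i ∈ Finset.range (n + m), h (Z i ω)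
        ∂(cond μ {ω | labelCount (fun i => Z i ω) (n + m) 1 = n}) =
      (∑ j, (condBin P 1 j : 𝕜) * h (j, 1)) ^ n * (∑ j, (condBin P 0 j : 𝕜) * h (j, 0)) ^ m := by
  have hpos := measureReal_labelCount_eq_pos hZ_meas hZ_indep hZ_law h1 h0 n m
  rw [ProbabilityTheory.cond, integral_smul_measure, setIntegral_labelCount_prod hZ_meas hZ_indep hZ_law,
    ← measureReal_labelCount_eq hZ_meas hZ_indep hZ_law h1 h0, ENNReal.toReal_inv,
    ← measureReal_def, RCLike.real_smul_eq_coe_mul, ← mul_assoc, ← RCLike.ofReal_mul,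
    inv_mul_cancel₀ hpos.ne', RCLike.ofReal_one, one_mul]

/-- Given that `n` of `n + m` labels are `1`, the class of label `y` has size `![m, n] y`. -/
theorem ae_cond_labelCount (hZ_meas : ∀ i, Measurable (Z i)) (n m : ℕ) :
    ∀ᵐ ω ∂(ProbabilityTheory.cond μ {ω | labelCount (fun i => Z i ω) (n + m) 1 = n}),
      ∀ y, labelCount (fun i => Z i ω) (n + m) y = ![m, n] y := by
  filter_upwards [ae_cond_mem (measurableSet_labelCount_eq hZ_meas (n + m) n 1)] with ω hω y
  have := labelCount_add (fun i => Z i ω) (n + m)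
  have hω' : labelCount (fun i => Z i ω) (n + m) 1 = n := hω
  fin_cases y
  · simp; omega
  · simpa using hω'

end Law

/-! ### The Jeffreys divergence to first order, and the variance functionals -/

/-- The partial derivative of `(x - y) log (x / y)` in `x`. -/
noncomputable def jeffreysSlope (x y : ℝ) : ℝ := 1 + Real.log (x / y) - y / x

theorem hasFDerivAt_sub_mul_log_div {x y : ℝ} (hx : 0 < x) (hy : 0 < y) :
    HasFDerivAt (fun w : ℝ × ℝ => (w.1 - w.2) * Real.log (w.1 / w.2))
      (jeffreysSlope x y • ContinuousLinearMap.fst ℝ ℝ ℝ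
        + jeffreysSlope y x • ContinuousLinearMap.snd ℝ ℝ ℝ) (x, y) := by
  have hlog : HasFDerivAt (fun w : ℝ × ℝ => Real.log w.1 - Real.log w.2)
      (x⁻¹ • ContinuousLinearMap.fst ℝ ℝ ℝ - y⁻¹ • ContinuousLinearMap.snd ℝ ℝ ℝ) (x, y) :=
    ((hasFDerivAt_fst (p := (x, y))).log hx.ne').sub ((hasFDerivAt_snd (p := (x, y))).log hy.ne')
  have h := ((hasFDerivAt_fst (𝕜 := ℝ) (p := (x, y))).sub hasFDerivAt_snd).mul hlog
  have hev : ∀ᶠ w : ℝ × ℝ in 𝓝 (x, y), 0 < w.1 ∧ 0 < w.2 :=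
    (continuousAt_fst.eventually (lt_mem_nhds hx)).and
      (continuousAt_snd.eventually (lt_mem_nhds hy))
  refine (h.congr_of_eventuallyEq (hev.mono fun w hw => ?_)).congr_fderiv ?_
  · simp [Real.log_div hw.1.ne' hw.2.ne']
  · ext <;> simp [jeffreysSlope, Real.log_div, hx.ne', hy.ne'] <;> field_simp <;> ring

/-- The linearization of the Jeffreys divergence at a pair of positive vectors, with the error
bounded by a small multiple of any common bound on the coordinates of the displacement. -/
theorem exists_jeffreys_sub_le {r : ℕ} {p q : Fin r → ℝ} (hp : ∀ j, 0 < p j)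
    (hq : ∀ j, 0 < q j) {η : ℝ} (hη : 0 < η) :
    ∃ δ > 0, ∀ x y : Fin r → ℝ, ∀ a b : ℝ, a < δ → b < δ →
      (∀ j, |x j - p j| ≤ a) → (∀ j, |y j - q j| ≤ b) →
      |jeffreys x y - jeffreys p q - (∑ j, jeffreysSlope (p j) (q j) * (x j - p j)
        + ∑ j, jeffreysSlope (q j) (p j) * (y j - q j))| ≤ r * (η * max a b) := by
  have hev : ∀ᶠ w : ℝ × ℝ in 𝓝 0, ∀ j,
      |(p j + w.1 - (q j + w.2)) * Real.log ((p j + w.1) / (q j + w.2))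
        - (p j - q j) * Real.log (p j / q j)
        - (jeffreysSlope (p j) (q j) * w.1 + jeffreysSlope (q j) (p j) * w.2)| ≤ η * ‖w‖ := by
    refine eventually_all.2 fun j => ?_
    have := (hasFDerivAt_iff_isLittleO_nhds_zero.1
      (hasFDerivAt_sub_mul_log_div (hp j) (hq j))).bound hη
    simpa using this
  obtain ⟨δ, hδ, hball⟩ := Metric.eventually_nhds_iff.1 hev
  refine ⟨δ, hδ, fun x y a b ha hb hx hy => ?_⟩
  simp only [jeffreys]
  rw [← Finset.sum_sub_distrib, ← Finset.sum_add_distrib, ← Finset.sum_sub_distrib]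
  refine (Finset.abs_sum_le_sum_abs _ _).trans ?_
  refine (Finset.sum_le_card_nsmul _ _ (η * max a b) fun j _ => ?_).trans_eq (by simp)
  have hn : ‖(x j - p j, y j - q j)‖ ≤ max a b := max_le_max (hx j) (hy j)
  have := hball (y := (x j - p j, y j - q j))
    (by rw [dist_zero_right]; exact hn.trans_lt (max_lt ha hb)) j
  simp only [add_sub_cancel] at this
  exact this.trans (by gcongr)

/-- The variance of `f` under the weights `p`, in the form of the definitions of `V₁`, `V₂`. -/
theorem sum_mul_one_sub_sub_eq_variance {r : ℕ} {p : Fin r → ℝ} (hp : ∑ j, p j = 1)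
    (f : Fin r → ℝ) :
    ∑ j, p j * (1 - p j) * f j ^ 2
      - 2 * ∑ ij : Fin r × Fin r with ij.1 < ij.2, p ij.1 * p ij.2 * f ij.1 * f ij.2 =
    ∑ j, p j * (f j - ∑ i, p i * f i) ^ 2 := by
  set a := ∑ i, p i * f i with ha
  have hR : ∑ j, p j * (f j - a) ^ 2 = ∑ j, p j * f j ^ 2 - a ^ 2 := by
    have : ∀ j, p j * (f j - a) ^ 2 = p j * f j ^ 2 - 2 * a * (p j * f j) + a ^ 2 * p j := by
      intro j; ring
    simp only [this, Finset.sum_add_distrib, Finset.sum_sub_distrib, ← Finset.mul_sum, ← ha, hp]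
    ring
  have hsq : a ^ 2 = ∑ j, (p j * f j) ^ 2
      + 2 * ∑ ij : Fin r × Fin r with ij.1 < ij.2, p ij.1 * p ij.2 * f ij.1 * f ij.2 := by
    have h1 : a ^ 2 = ∑ ij : Fin r × Fin r, p ij.1 * p ij.2 * f ij.1 * f ij.2 := by
      rw [sq, ha, Finset.sum_mul_sum, Fintype.sum_prod_type]
      exact Finset.sum_congr rfl fun i _ => Finset.sum_congr rfl fun j _ => by ring
    have h2 : ∑ ij : Fin r × Fin r with ij.2 < ij.1, p ij.1 * p ij.2 * f ij.1 * f ij.2 =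
        ∑ ij : Fin r × Fin r with ij.1 < ij.2, p ij.1 * p ij.2 * f ij.1 * f ij.2 := by
      refine Finset.sum_nbij' Prod.swap Prod.swap ?_ ?_ ?_ ?_ ?_ <;> simp
      intros; ring
    have h3 : ∑ ij : Fin r × Fin r with ij.1 = ij.2, p ij.1 * p ij.2 * f ij.1 * f ij.2 =
        ∑ j, (p j * f j) ^ 2 := by
      rw [Finset.sum_filter, Fintype.sum_prod_type]
      refine Finset.sum_congr rfl fun i _ => ?_
      simp; ring
    have h4 : ∑ ij : Fin r × Fin r, p ij.1 * p ij.2 * f ij.1 * f ij.2 =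
        ∑ ij : Fin r × Fin r with ij.1 = ij.2, p ij.1 * p ij.2 * f ij.1 * f ij.2 +
        (∑ ij : Fin r × Fin r with ij.1 < ij.2, p ij.1 * p ij.2 * f ij.1 * f ij.2 +
        ∑ ij : Fin r × Fin r with ij.2 < ij.1, p ij.1 * p ij.2 * f ij.1 * f ij.2) := by
      simp only [Finset.sum_filter, ← Finset.sum_add_distrib]
      refine Finset.sum_congr rfl fun ij _ => ?_
      rcases lt_trichotomy ij.1 ij.2 with h | h | h
      · simp [h, h.ne, h.not_gt]
      · simp [h]
      · simp [h, h.ne', h.not_gt]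
    rw [h1, h4, h2, h3]
    ring
  have hL : ∑ j, p j * (1 - p j) * f j ^ 2 = ∑ j, p j * f j ^ 2 - ∑ j, (p j * f j) ^ 2 := by
    rw [← Finset.sum_sub_distrib]
    exact Finset.sum_congr rfl fun j _ => by ring
  rw [hL, hR, hsq]
  ring

theorem V₁_eq_variance {r : ℕ} {p : Fin r → ℝ} (hp : ∑ j, p j = 1) (q : Fin r → ℝ) :
    V₁ p q = ∑ j, p j *
      (jeffreysSlope (p j) (q j) - ∑ i, p i * jeffreysSlope (p i) (q i)) ^ 2 :=
  sum_mul_one_sub_sub_eq_variance hp fun j => jeffreysSlope (p j) (q j)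

theorem jeffreysSlope_strictMono {t s x y : ℝ} (ht : 0 < t) (hs : 0 < s) (hx : 0 < x) (hy : 0 < y)
    (h : t / s < x / y) : jeffreysSlope t s < jeffreysSlope x y := by
  have h1 := Real.log_lt_log (div_pos ht hs) h
  have h2 : y / x < s / t := by
    rw [div_lt_div_iff₀ hs hy] at h
    rw [div_lt_div_iff₀ hx ht]
    linarith
  unfold jeffreysSlope
  linarith

/-- The slope is strictly monotone in the likelihood ratio `p j / q j`, which is not constant when
`p ≠ q`, so the slope is not constant either. -/
theorem V₁_pos {r : ℕ} {p q : Fin r → ℝ} (hp : ∀ j, 0 < p j) (hq : ∀ j, 0 < q j)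
    (hp1 : ∑ j, p j = 1) (hq1 : ∑ j, q j = 1) (hpq : p ≠ q) : 0 < V₁ p q := by
  rw [V₁_eq_variance hp1]
  set a := ∑ i, p i * jeffreysSlope (p i) (q i)
  have hnn : ∀ j ∈ Finset.univ, 0 ≤ p j * (jeffreysSlope (p j) (q j) - a) ^ 2 :=
    fun j _ => mul_nonneg (hp j).le (sq_nonneg _)
  refine lt_of_le_of_ne (Finset.sum_nonneg hnn) fun h0 => ?_
  have hconst : ∀ j, jeffreysSlope (p j) (q j) = a := fun j => by
    have := (Finset.sum_eq_zero_iff_of_nonneg hnn).1 h0.symm j (Finset.mem_univ j)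
    rcases mul_eq_zero.1 this with h | h
    · exact absurd h (hp j).ne'
    · exact sub_eq_zero.1 (pow_eq_zero_iff two_ne_zero |>.1 h)
  have hne : ∃ j, p j < q j := by
    by_contra! H
    refine hpq (funext fun j => ?_)
    exact ((Finset.sum_eq_sum_iff_of_le fun j _ => H j).1 (hq1.trans hp1.symm) j
      (Finset.mem_univ j)).symm
  have hne' : ∃ j, q j < p j := by
    by_contra! H
    refine hpq (funext fun j => ?_)
    exact (Finset.sum_eq_sum_iff_of_le fun j _ => H j).1 (hp1.trans hq1.symm) j
      (Finset.mem_univ j)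
  obtain ⟨i, hi⟩ := hne
  obtain ⟨j, hj⟩ := hne'
  have := jeffreysSlope_strictMono (hp i) (hq i) (hp j) (hq j)
    (((div_lt_one (hq i)).2 hi).trans ((one_lt_div (hq j)).2 hj))
  rw [hconst, hconst] at this
  exact lt_irrefl _ this

/-! ### Powers of a characteristic function -/

theorem norm_pow_sub_pow_le_mul {R : Type*} [NormedCommRing R] [NormOneClass R] {a b : R}
    (ha : ‖a‖ ≤ 1) (hb : ‖b‖ ≤ 1) (n : ℕ) : ‖a ^ n - b ^ n‖ ≤ n * ‖a - b‖ := by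
  induction n with
  | zero => simp
  | succ n ih =>
    have : a ^ (n + 1) - b ^ (n + 1) = a ^ n * (a - b) + (a ^ n - b ^ n) * b := by ring
    rw [this]
    have han : ‖a ^ n‖ ≤ 1 := (norm_pow_le a n).trans (pow_le_one₀ (norm_nonneg _) ha)
    calc ‖a ^ n * (a - b) + (a ^ n - b ^ n) * b‖
        ≤ ‖a ^ n‖ * ‖a - b‖ + ‖a ^ n - b ^ n‖ * ‖b‖ :=
          (norm_add_le _ _).trans (add_le_add (norm_mul_le _ _) (norm_mul_le _ _))
      _ ≤ 1 * ‖a - b‖ + (n * ‖a - b‖) * 1 := by gcongr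
      _ = _ := by push_cast; ring

/-- The characteristic function of the law with weights `p` on the values `f`. -/
noncomputable def weightedCharFun {r : ℕ} (p f : Fin r → ℝ) (u : ℝ) : ℂ :=
  ∑ j, (p j : ℂ) * Complex.exp ((u * f j : ℝ) * Complex.I)

theorem norm_weightedCharFun_le {r : ℕ} {p : Fin r → ℝ} (hp : ∀ j, 0 ≤ p j) (hp1 : ∑ j, p j = 1)
    (f : Fin r → ℝ) (u : ℝ) : ‖weightedCharFun p f u‖ ≤ 1 := by
  refine (norm_sum_le _ _).trans_eq ?_
  rw [← hp1]
  refine Finset.sum_congr rfl fun j _ => ?_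
  rw [norm_mul, Complex.norm_exp_ofReal_mul_I, Complex.norm_of_nonneg (hp j), mul_one]

theorem exp_sub_quadratic_isLittleO (a : ℂ) :
    (fun u : ℝ => Complex.exp (u * a) - (1 + u * a + (u * a) ^ 2 / 2)) =o[𝓝 0]
      fun u : ℝ => u ^ 2 := by
  have ht : Tendsto (fun u : ℝ => (u : ℂ) * a) (𝓝 0) (𝓝 0) := by
    have : Continuous fun u : ℝ => (u : ℂ) * a := by fun_prop
    simpa using this.tendsto 0
  have h := (Complex.exp_sub_sum_range_isBigO_pow 3).comp_tendsto ht
  simp only [Function.comp_def, Finset.sum_range_succ, Finset.sum_range_zero] at h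
  have h2 : (fun u : ℝ => ((u : ℂ) * a) ^ 3) =o[𝓝 0] fun u : ℝ => u ^ 2 := by
    have h3 : (fun u : ℝ => ((u : ℂ) * a) ^ 3) =O[𝓝 0] fun u : ℝ => u ^ 3 := by
      refine Asymptotics.IsBigO.of_bound (‖a‖ ^ 3) (Eventually.of_forall fun u => ?_)
      simp [mul_pow, mul_comm]
    exact h3.trans_isLittleO (Asymptotics.isLittleO_pow_pow (by norm_num))
  refine (h.trans_isLittleO h2).congr_left fun u => ?_
  simp

theorem weightedCharFun_sub_exp_isLittleO {r : ℕ} {p f : Fin r → ℝ} (hp1 : ∑ j, p j = 1)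
    (hf : ∑ j, p j * f j = 0) :
    (fun u : ℝ => weightedCharFun p f u
      - Complex.exp (-((∑ j, p j * f j ^ 2 : ℝ) : ℂ) * u ^ 2 / 2)) =o[𝓝 0]
      fun u : ℝ => u ^ 2 := by
  have hA : (fun u : ℝ => ∑ j, (p j : ℂ) * (Complex.exp (u * (f j * Complex.I)) -
      (1 + u * (f j * Complex.I) + (u * (f j * Complex.I)) ^ 2 / 2))) =o[𝓝 0]
      fun u : ℝ => u ^ 2 :=
    Asymptotics.IsLittleO.fun_sum fun j _ => (exp_sub_quadratic_isLittleO _).const_mul_left _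
  have hB : (fun u : ℝ => Complex.exp (-((∑ j, p j * f j ^ 2 : ℝ) : ℂ) * u ^ 2 / 2) -
      (1 + -((∑ j, p j * f j ^ 2 : ℝ) : ℂ) * u ^ 2 / 2)) =o[𝓝 0] fun u : ℝ => u ^ 2 := by
    set v : ℂ := -((∑ j, p j * f j ^ 2 : ℝ) : ℂ)
    have ht : Tendsto (fun u : ℝ => u ^ 2) (𝓝 0) (𝓝 0) := by
      have : Continuous fun u : ℝ => u ^ 2 := by fun_prop
      simpa using this.tendsto 0
    have h := (Complex.exp_sub_sum_range_isBigO_pow 2).comp_tendsto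
      (show Tendsto (fun u : ℝ => v * u ^ 2 / 2) (𝓝 0) (𝓝 0) by
        have : Continuous fun u : ℝ => v * (u : ℂ) ^ 2 / 2 := by fun_prop
        simpa using this.tendsto 0)
    simp only [Function.comp_def, Finset.sum_range_succ, Finset.sum_range_zero] at h
    have h3 : (fun u : ℝ => (v * u ^ 2 / 2) ^ 2) =o[𝓝 0] fun u : ℝ => u ^ 2 := by
      have h4 : (fun u : ℝ => (v * u ^ 2 / 2) ^ 2) =O[𝓝 0] fun u : ℝ => u ^ 4 := by
        refine Asymptotics.IsBigO.of_bound (‖v‖ ^ 2 / 4) (Eventually.of_forall fun u => le_of_eq ?_)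
        simp only [norm_pow, norm_mul, norm_div, Complex.norm_real, Complex.norm_ofNat]
        ring
      exact h4.trans_isLittleO (Asymptotics.isLittleO_pow_pow (by norm_num))
    refine (h.trans_isLittleO h3).congr_left fun u => ?_
    simp
  refine (hA.sub hB).congr_left fun u => ?_
  have hp1' : ∑ j, (p j : ℂ) = 1 := by exact_mod_cast hp1
  have hf' : ∑ j, (p j : ℂ) * f j = 0 := by exact_mod_cast hf
  have hexp : ∀ j, (p j : ℂ) * (Complex.exp (u * (f j * Complex.I)) -
      (1 + u * (f j * Complex.I) + (u * (f j * Complex.I)) ^ 2 / 2)) =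
      (p j : ℂ) * Complex.exp ((u * f j : ℝ) * Complex.I) - (p j : ℂ)
        - (u * Complex.I) * (p j * f j) + u ^ 2 / 2 * (p j * f j ^ 2) := by
    intro j
    have : (u * (f j * Complex.I)) ^ 2 = - ((u : ℂ) ^ 2 * (f j) ^ 2) := by
      rw [mul_pow, mul_pow, Complex.I_sq]; ring
    rw [this]
    push_cast
    rw [mul_assoc (u : ℂ) (f j : ℂ) Complex.I]
    ring
  simp only [hexp, Finset.sum_add_distrib, Finset.sum_sub_distrib, ← Finset.mul_sum, hp1', hf',
    weightedCharFun]
  push_cast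
  ring

/-- Uniform version of the central limit theorem for sums of i.i.d. variables at the level of
characteristic functions: the argument `u` may be any null sequence with `n u²` bounded. -/
theorem exists_weightedCharFun_pow_sub_le {r : ℕ} {p f : Fin r → ℝ} (hp : ∀ j, 0 ≤ p j)
    (hp1 : ∑ j, p j = 1) (hf : ∑ j, p j * f j = 0) {ε : ℝ} (hε : 0 < ε) :
    ∃ δ > 0, ∀ (n : ℕ) (u : ℝ), |u| < δ →
      ‖weightedCharFun p f u ^ n
        - Complex.exp (-((n * u ^ 2 * ∑ j, p j * f j ^ 2 : ℝ) : ℂ) / 2)‖ ≤ ε * (n * u ^ 2) := by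
  obtain ⟨δ, hδ, hball⟩ := Metric.eventually_nhds_iff.1
    ((weightedCharFun_sub_exp_isLittleO hp1 hf).bound hε)
  refine ⟨δ, hδ, fun n u hu => ?_⟩
  have h1 := hball (y := u) (by rwa [dist_zero_right])
  have hv : 0 ≤ ∑ j, p j * f j ^ 2 :=
    Finset.sum_nonneg fun j _ => mul_nonneg (hp j) (sq_nonneg _)
  have h2 : ‖Complex.exp (-((∑ j, p j * f j ^ 2 : ℝ) : ℂ) * u ^ 2 / 2)‖ ≤ 1 := by
    have : -((∑ j, p j * f j ^ 2 : ℝ) : ℂ) * u ^ 2 / 2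
        = ((-((∑ j, p j * f j ^ 2) * u ^ 2 / 2) : ℝ) : ℂ) := by push_cast; ring
    rw [this, Complex.norm_exp_ofReal, Real.exp_le_one_iff]
    have := mul_nonneg hv (sq_nonneg u)
    linarith
  have h3 : Complex.exp (-((n * u ^ 2 * ∑ j, p j * f j ^ 2 : ℝ) : ℂ) / 2) =
      Complex.exp (-((∑ j, p j * f j ^ 2 : ℝ) : ℂ) * u ^ 2 / 2) ^ n := by
    rw [← Complex.exp_nat_mul]
    congr 1
    push_cast
    ring
  rw [h3]
  refine (norm_pow_sub_pow_le_mul (norm_weightedCharFun_le hp hp1 f u) h2 n).trans ?_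
  calc (n : ℝ) * _ ≤ n * (ε * ‖u ^ 2‖) := by gcongr
    _ = ε * (n * u ^ 2) := by rw [Real.norm_of_nonneg (sq_nonneg u)]; ring

/-! ### Empirical means given the class sizes -/

section Empirical

variable {r : ℕ}

/-- The centering of `f` under the weights `p`. -/
def centered (p f : Fin r → ℝ) (j : Fin r) : ℝ := f j - ∑ i, p i * f i

theorem sum_mul_centered {p : Fin r → ℝ} (hp : ∑ j, p j = 1) (f : Fin r → ℝ) :
    ∑ j, p j * centered p f j = 0 := by
  simp only [centered, mul_sub, Finset.sum_sub_distrib, ← Finset.sum_mul, hp, one_mul, sub_self]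

theorem sum_mul_empBin_sub {z : ℕ → Fin r × Fin 2} {N s : ℕ} {y : Fin 2}
    (hs : labelCount z N y = s) (hs0 : 0 < s) (p f : Fin r → ℝ) :
    ∑ j, f j * (empBin z N y j - p j) =
      (∑ i ∈ Finset.range N, if (z i).2 = y then centered p f (z i).1 else 0) / s := by
  have hs' : (s : ℝ) ≠ 0 := by positivity
  have hsum : ∑ j, (binCount z N y j : ℝ) = s := by rw [← hs, labelCount]; push_cast; rfl
  rw [← sum_binCount_mul, eq_div_iff hs', Finset.sum_mul]
  simp only [centered, mul_sub, Finset.sum_sub_distrib, ← Finset.sum_mul, hsum, empBin, hs]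
  rw [sub_mul, Finset.sum_mul]
  congr 1
  · refine Finset.sum_congr rfl fun j _ => ?_
    field_simp
  · rw [mul_comm]
    congr 1
    exact Finset.sum_congr rfl fun j _ => mul_comm _ _

/-- Exponential moments of a normalized sum of `s` centered variables with values in `[-1, 1]`
are bounded uniformly in `s`. -/
theorem sum_mul_exp_div_sqrt_pow_le {p f : Fin r → ℝ} (hp : ∀ j, 0 ≤ p j) (hp1 : ∑ j, p j = 1)
    (hf : ∑ j, p j * f j = 0) (hf1 : ∀ j, |f j| ≤ 1) {s : ℕ} (hs : 0 < s) :
    (∑ j, p j * Real.exp (f j / √s)) ^ s ≤ Real.exp 1 := by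
  have hs' : (0 : ℝ) < s := by positivity
  have hs1 : (1 : ℝ) ≤ √s := Real.one_le_sqrt.2 (by exact_mod_cast hs)
  have hterm : ∀ j, p j * Real.exp (f j / √s) ≤ p j + p j * f j / √s + p j * (1 / s) := by
    intro j
    have h1 : |f j / √s| ≤ 1 := by
      rw [abs_div, abs_of_pos (by positivity : 0 < √(s : ℝ))]
      exact (div_le_one (by positivity)).2 ((hf1 j).trans hs1)
    have h2 := (abs_le.1 (Real.abs_exp_sub_one_sub_id_le h1)).2
    have h3 : (f j / √s) ^ 2 ≤ 1 / s := by
      rw [div_pow, Real.sq_sqrt hs'.le]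
      gcongr
      rw [sq_le_one_iff_abs_le_one]
      exact hf1 j
    calc p j * Real.exp (f j / √s) ≤ p j * (1 + f j / √s + 1 / s) :=
          mul_le_mul_of_nonneg_left (by linarith) (hp j)
      _ = _ := by ring
  have hle : ∑ j, p j * Real.exp (f j / √s) ≤ Real.exp (1 / s) := by
    refine (Finset.sum_le_sum fun j _ => hterm j).trans ?_
    rw [Finset.sum_add_distrib, Finset.sum_add_distrib, ← Finset.sum_div, ← Finset.sum_mul, hf,
      hp1]
    have := Real.add_one_le_exp (1 / (s : ℝ))
    simp only [zero_div, add_zero, one_mul]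
    linarith
  calc _ ≤ Real.exp (1 / s) ^ s := by
        gcongr
        exact Finset.sum_nonneg fun j _ => mul_nonneg (hp j) (Real.exp_pos _).le
    _ = Real.exp 1 := by rw [← Real.exp_nat_mul, mul_one_div_cancel hs'.ne']

end Empirical

section Conditional

variable {r : ℕ} {P : Measure (Fin r × Fin 2)} [IsProbabilityMeasure P]
  {Ω : Type*} [MeasurableSpace Ω] {μ : Measure Ω} [IsProbabilityMeasure μ]
  {Z : ℕ → Ω → Fin r × Fin 2}

theorem isProbabilityMeasure_cond_labelCount (hZ_meas : ∀ i, Measurable (Z i))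
    (hZ_indep : iIndepFun Z μ) (hZ_law : ∀ i, μ.map (Z i) = P)
    (h1 : 0 < P.real {z | z.2 = 1}) (h0 : 0 < P.real {z | z.2 = 0}) (n m : ℕ) :
    IsProbabilityMeasure
      (ProbabilityTheory.cond μ {ω | labelCount (fun i => Z i ω) (n + m) 1 = n}) := by
  refine cond_isProbabilityMeasure fun h => ?_
  have := measureReal_labelCount_eq_pos hZ_meas hZ_indep hZ_law h1 h0 n m
  simp [measureReal_def, h] at this

/-- Given the class sizes, normalized sums over one class have exponential moments bounded
uniformly in the class sizes. -/
theorem mgf_cond_le (hZ_meas : ∀ i, Measurable (Z i))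
    (hZ_indep : iIndepFun Z μ) (hZ_law : ∀ i, μ.map (Z i) = P)
    (h1 : 0 < P.real {z | z.2 = 1}) (h0 : 0 < P.real {z | z.2 = 0}) (n m : ℕ) (y : Fin 2)
    (hs : 0 < (![m, n] y : ℕ)) {f : Fin r → ℝ} (hf : ∑ j, condBin P y j * f j = 0)
    (hf1 : ∀ j, |f j| ≤ 1) :
    ∫ ω, Real.exp ((∑ i ∈ Finset.range (n + m), if (Z i ω).2 = y then f (Z i ω).1 else 0)
        / √(![m, n] y : ℕ))
      ∂(ProbabilityTheory.cond μ {ω | labelCount (fun i => Z i ω) (n + m) 1 = n})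
      ≤ Real.exp 1 := by
  have hprod : ∀ ω, Real.exp ((∑ i ∈ Finset.range (n + m),
        if (Z i ω).2 = y then f (Z i ω).1 else 0) / √(![m, n] y : ℕ)) =
      ∏ i ∈ Finset.range (n + m), (fun z : Fin r × Fin 2 =>
        Real.exp ((if z.2 = y then f z.1 else 0) / √(![m, n] y : ℕ))) (Z i ω) := fun ω => by
    rw [Finset.sum_div, Real.exp_sum]
  refine ((integral_congr_ae (ae_of_all _ hprod)).trans (integral_cond_prod (𝕜 := ℝ) hZ_meas hZ_indep
    hZ_law h1 h0 n m fun z => Real.exp ((if z.2 = y then f z.1 else 0) / √(![m, n] y : ℕ)))).trans_le ?_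
  have hnn : ∀ y j, 0 ≤ condBin P y j := fun y j => measureReal_nonneg
  have key : ∀ s : ℕ, 0 < s → (∑ j, condBin P y j * Real.exp (f j / √s)) ^ s ≤ Real.exp 1 :=
    fun s hs => sum_mul_exp_div_sqrt_pow_le (hnn y)
      (sum_condBin (by fin_cases y; exacts [h0, h1])) hf hf1 hs
  fin_cases y
  · simpa [sum_condBin h1] using key m hs
  · simpa [sum_condBin h0] using key n hs

theorem integrable_cond_comp_finite {𝕜 : Type*} [RCLike 𝕜]
    (hZ_meas : ∀ i, Measurable (Z i)) (N : ℕ) (E : Set Ω)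
    (g : (Fin N → Fin r × Fin 2) → 𝕜) :
    Integrable (fun ω => g fun i => Z i ω) (ProbabilityTheory.cond μ E) := by
  rcases eq_or_ne (μ E) 0 with h | h
  · rw [cond_eq_zero_of_meas_eq_zero h]
    exact integrable_zero_measure
  · exact ((integrable_comp_finite hZ_meas N g).restrict).smul_measure (ENNReal.inv_ne_top.2 h)

/-- Given the class sizes, the empirical frequencies deviate from the true ones by more than
`K / √s` with exponentially small probability in `K`, uniformly in the class size `s`. -/
theorem measureReal_cond_empBin_le (hZ_meas : ∀ i, Measurable (Z i))
    (hZ_indep : iIndepFun Z μ) (hZ_law : ∀ i, μ.map (Z i) = P)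
    (h1 : 0 < P.real {z | z.2 = 1}) (h0 : 0 < P.real {z | z.2 = 0}) (n m : ℕ) (y : Fin 2)
    (hs : 0 < (![m, n] y : ℕ)) (j : Fin r) (K : ℝ) :
    (ProbabilityTheory.cond μ {ω | labelCount (fun i => Z i ω) (n + m) 1 = n}).real
      {ω | K ≤ √(![m, n] y : ℕ) * |empBin (fun i => Z i ω) (n + m) y j - condBin P y j|}
      ≤ 2 * Real.exp (1 - K) := by
  set ν := ProbabilityTheory.cond μ {ω | labelCount (fun i => Z i ω) (n + m) 1 = n} with hν
  have := isProbabilityMeasure_cond_labelCount hZ_meas hZ_indep hZ_law h1 h0 n m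
  set s : ℕ := ![m, n] y with hsdef
  have hy : 0 < P.real {z | z.2 = y} := by fin_cases y; exacts [h0, h1]
  have hnn : ∀ j, 0 ≤ condBin P y j := fun j => measureReal_nonneg
  -- The deviation of the frequency of `j` is the empirical mean of the centered indicator of `j`.
  set e : Fin r → ℝ := centered (condBin P y) (Pi.single j 1) with he
  have he0 : ∑ j, condBin P y j * e j = 0 := sum_mul_centered (sum_condBin hy) _
  have he1 : ∀ l, |e l| ≤ 1 := by
    intro l
    have hle : condBin P y j ≤ 1 := by
      rw [← sum_condBin hy]
      exact Finset.single_le_sum (fun l _ => hnn l) (Finset.mem_univ j)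
    have : ∑ i, condBin P y i * (Pi.single j 1 : Fin r → ℝ) i = condBin P y j := by
      simp [Pi.single_apply]
    rw [he, centered, this, Pi.single_apply, abs_le]
    have := hnn j
    split_ifs <;> constructor <;> linarith
  set X : ℝ → Ω → ℝ := fun σ ω =>
    (∑ i ∈ Finset.range (n + m), if (Z i ω).2 = y then σ * e (Z i ω).1 else 0) / √s with hX
  have hone : ∀ σ : ℝ, |σ| = 1 → ν.real {ω | K ≤ X σ ω} ≤ Real.exp (1 - K) := by
    intro σ hσ
    have hint : Integrable (fun ω => Real.exp (1 * X σ ω)) ν := by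
      refine (integrable_cond_comp_finite hZ_meas (n + m) _ (fun z => Real.exp (1 *
        ((∑ i : Fin (n + m), if (z i).2 = y then σ * e (z i).1 else 0) / √s)))).congr
        (ae_of_all _ fun ω => ?_)
      simp only [hX, Finset.sum_range]
    refine (measure_ge_le_exp_mul_mgf K zero_le_one hint).trans ?_
    have hm := mgf_cond_le hZ_meas hZ_indep hZ_law h1 h0 n m y hs (f := fun l => σ * e l)
      (by simp only [mul_left_comm _ σ, ← Finset.mul_sum, he0, mul_zero])
      (fun l => by rw [abs_mul, hσ, one_mul]; exact he1 l)
    calc Real.exp (-1 * K) * mgf (X σ) ν 1 ≤ Real.exp (-1 * K) * Real.exp 1 := by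
          gcongr
          simpa [mgf, hX] using hm
      _ = Real.exp (1 - K) := by rw [← Real.exp_add]; ring_nf
  have hsub : {ω | K ≤ √s * |empBin (fun i => Z i ω) (n + m) y j - condBin P y j|} ≤ᵐ[ν]
      ({ω | K ≤ X 1 ω} ∪ {ω | K ≤ X (-1) ω} : Set Ω) := by
    filter_upwards [ae_cond_labelCount hZ_meas n m] with ω hω hK
    have hlin := sum_mul_empBin_sub (hω y) hs (condBin P y) (Pi.single j 1)
    have hl : ∑ l, (Pi.single j 1 : Fin r → ℝ) l *
        (empBin (fun i => Z i ω) (n + m) y l - condBin P y l) =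
        empBin (fun i => Z i ω) (n + m) y j - condBin P y j := by simp [Pi.single_apply]
    rw [hl] at hlin
    have hsq : √(s : ℝ) * √s = s := Real.mul_self_sqrt (Nat.cast_nonneg _)
    have hs0 : (0 : ℝ) < √s := Real.sqrt_pos.2 (by exact_mod_cast hs)
    have hX1 : √s * (empBin (fun i => Z i ω) (n + m) y j - condBin P y j) = X 1 ω := by
      simp only [hX, one_mul]
      rw [hlin, ← hsdef, eq_div_iff hs0.ne', mul_right_comm, hsq,
        mul_div_cancel₀ _ (by positivity)]
    have hX2 : X (-1) ω = - X 1 ω := by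
      simp only [hX, ← neg_div, ← Finset.sum_neg_distrib]
      congr 1
      exact Finset.sum_congr rfl fun i _ => by split_ifs <;> simp
    have hK' : K ≤ |X 1 ω| := by
      rw [← hX1, abs_mul, abs_of_pos hs0]
      exact hK
    rcases le_abs.1 hK' with h | h
    · exact Or.inl h
    · exact Or.inr (by rw [← hX2] at h; exact h)
  calc ν.real _ ≤ ν.real ({ω | K ≤ X 1 ω} ∪ {ω | K ≤ X (-1) ω}) :=
        ENNReal.toReal_mono (measure_ne_top _ _) (measure_mono_ae hsub)
    _ ≤ _ := measureReal_union_le _ _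
    _ ≤ Real.exp (1 - K) + Real.exp (1 - K) :=
        add_le_add (hone 1 (by simp)) (hone (-1) (by simp))
    _ = 2 * Real.exp (1 - K) := by ring

end Conditional

/-! ### The normalized error given the class sizes -/

section Scale

/-- The normalizing factor `(n m / (m v + n w))^(1/2)`. -/
noncomputable def errorScale (v w : ℝ) (n m : ℕ) : ℝ := √((n * m : ℝ) / (m * v + n * w))

variable {v w : ℝ} {n m : ℕ}

theorem errorScale_nonneg : 0 ≤ errorScale v w n m := Real.sqrt_nonneg _

/-- The variances of the two parts of the linearized error add up to `1`. -/
theorem errorScale_sq_add (hv : 0 < v) (hw : 0 < w) (hn : 0 < n) (hm : 0 < m) :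
    n * (errorScale v w n m / n) ^ 2 * v + m * (errorScale v w n m / m) ^ 2 * w = 1 := by
  have hn' : (0 : ℝ) < n := by exact_mod_cast hn
  have hm' : (0 : ℝ) < m := by exact_mod_cast hm
  rw [div_pow, div_pow, errorScale, Real.sq_sqrt (by positivity)]
  field_simp

theorem errorScale_sq_left_le (hv : 0 < v) (hw : 0 < w) (hn : 0 < n) (hm : 0 < m) :
    n * (errorScale v w n m / n) ^ 2 ≤ 1 / v := by
  rw [le_div_iff₀ hv, ← errorScale_sq_add hv hw hn hm, le_add_iff_nonneg_right]
  positivity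

theorem errorScale_sq_right_le (hv : 0 < v) (hw : 0 < w) (hn : 0 < n) (hm : 0 < m) :
    m * (errorScale v w n m / m) ^ 2 ≤ 1 / w := by
  rw [le_div_iff₀ hw, ← errorScale_sq_add hv hw hn hm, le_add_iff_nonneg_left]
  positivity

theorem div_sqrt_le_of_mul_div_sq_le {c b : ℝ} {n : ℕ} (hn : 0 < n)
    (h : n * (c / n) ^ 2 ≤ 1 / b) : c / √n ≤ √(1 / b) := by
  refine Real.le_sqrt_of_sq_le (le_trans (le_of_eq ?_) h)
  have hn' : (0 : ℝ) < n := by exact_mod_cast hn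
  rw [div_pow, div_pow, Real.sq_sqrt hn'.le]
  field_simp

theorem abs_div_le_of_mul_div_sq_le {c b : ℝ} {n : ℕ} (hn : 0 < n)
    (h : n * (c / n) ^ 2 ≤ 1 / b) : |c / n| ≤ √(1 / b) / √n := by
  have hn' : (0 : ℝ) < n := by exact_mod_cast hn
  rw [← Real.sqrt_div' _ hn'.le, ← Real.sqrt_sq_eq_abs]
  exact Real.sqrt_le_sqrt ((le_div_iff₀' hn').2 h)

end Scale

theorem eventually_div_sqrt_lt (C : ℝ) {δ : ℝ} (hδ : 0 < δ) :
    ∀ᶠ n : ℕ in atTop, C / √n < δ := by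
  have : Tendsto (fun n : ℕ => C / √(n : ℝ)) atTop (𝓝 0) :=
    tendsto_const_nhds.div_atTop (Real.tendsto_sqrt_atTop.comp tendsto_natCast_atTop_atTop)
  exact this.eventually (gt_mem_nhds hδ)

/-- The first-order approximation of the normalized error for class sizes `n` and `m`. -/
noncomputable def linearError {r : ℕ} (p q : Fin r → ℝ) (z : ℕ → Fin r × Fin 2) (n m : ℕ) : ℝ :=
  errorScale (V₁ p q) (V₂ p q) n m *
    (∑ j, jeffreysSlope (p j) (q j) * (empBin z (n + m) 1 j - p j)
      + ∑ j, jeffreysSlope (q j) (p j) * (empBin z (n + m) 0 j - q j))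

/-- The limit of characteristic functions behind the central limit theorem: two independent sums,
whose normalized variances add up to `1` in proportions that may vary with `n` and `m`. -/
theorem tendsto_weightedCharFun_pow_mul {r : ℕ} {p q f g : Fin r → ℝ} (hp : ∀ j, 0 ≤ p j)
    (hq : ∀ j, 0 ≤ q j) (hp1 : ∑ j, p j = 1) (hq1 : ∑ j, q j = 1)
    (hf : ∑ j, p j * f j = 0) (hg : ∑ j, q j * g j = 0)
    (hv : 0 < ∑ j, p j * f j ^ 2) (hw : 0 < ∑ j, q j * g j ^ 2) (t : ℝ) :
    Tendsto (fun k : ℕ × ℕ =>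
      weightedCharFun p f
        (t * (errorScale (∑ j, p j * f j ^ 2) (∑ j, q j * g j ^ 2) k.1 k.2 / k.1)) ^ k.1 *
      weightedCharFun q g
        (t * (errorScale (∑ j, p j * f j ^ 2) (∑ j, q j * g j ^ 2) k.1 k.2 / k.2)) ^ k.2)
      (atTop ×ˢ atTop) (𝓝 (Complex.exp (-(t : ℂ) ^ 2 / 2))) := by
  set v := ∑ j, p j * f j ^ 2 with hvdef
  set w := ∑ j, q j * g j ^ 2 with hwdef
  rw [Metric.tendsto_nhds]
  intro ε hε
  set η := ε / (t ^ 2 * (1 / v) + t ^ 2 * (1 / w) + 1) with hη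
  have hη0 : 0 < η := by positivity
  have hηε : η * (t ^ 2 * (1 / v)) + η * (t ^ 2 * (1 / w)) < ε := by
    rw [← mul_add, hη, div_mul_eq_mul_div, div_lt_iff₀ (by positivity)]
    nlinarith
  obtain ⟨δ₁, hδ₁, h₁⟩ := exists_weightedCharFun_pow_sub_le hp hp1 hf hη0
  obtain ⟨δ₂, hδ₂, h₂⟩ := exists_weightedCharFun_pow_sub_le hq hq1 hg hη0
  filter_upwards [prod_mem_prod
    ((eventually_gt_atTop 0).and (eventually_div_sqrt_lt (|t| * √(1 / v)) hδ₁))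
    ((eventually_gt_atTop 0).and (eventually_div_sqrt_lt (|t| * √(1 / w)) hδ₂))] with k hk
  obtain ⟨⟨hn, hn'⟩, ⟨hm, hm'⟩⟩ := hk
  set n := k.1
  set m := k.2
  set c := errorScale v w n m with hc
  have hL := errorScale_sq_left_le hv hw hn hm
  have hR := errorScale_sq_right_le hv hw hn hm
  rw [← hc] at hL hR
  have e₁ := h₁ n (t * (c / n)) (by
    rw [abs_mul]
    refine lt_of_le_of_lt ?_ hn'
    rw [mul_div_assoc]
    exact mul_le_mul_of_nonneg_left (abs_div_le_of_mul_div_sq_le hn hL) (abs_nonneg t))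
  have e₂ := h₂ m (t * (c / m)) (by
    rw [abs_mul]
    refine lt_of_le_of_lt ?_ hm'
    rw [mul_div_assoc]
    exact mul_le_mul_of_nonneg_left (abs_div_le_of_mul_div_sq_le hm hR) (abs_nonneg t))
  rw [← hvdef] at e₁
  rw [← hwdef] at e₂
  set A := weightedCharFun p f (t * (c / n)) ^ n
  set B := weightedCharFun q g (t * (c / m)) ^ m with hB
  set A' := Complex.exp (-((n * (t * (c / n)) ^ 2 * v : ℝ) : ℂ) / 2) with hA'
  set B' := Complex.exp (-((m * (t * (c / m)) ^ 2 * w : ℝ) : ℂ) / 2) with hB'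
  have hlim : Complex.exp (-(t : ℂ) ^ 2 / 2) = A' * B' := by
    rw [hA', hB', ← Complex.exp_add]
    congr 1
    have := errorScale_sq_add hv hw hn hm
    rw [← hc] at this
    have h3 : n * (t * (c / n)) ^ 2 * v + m * (t * (c / m)) ^ 2 * w = t ^ 2 := by
      calc _ = t ^ 2 * (n * (c / n) ^ 2 * v + m * (c / m) ^ 2 * w) := by ring
        _ = t ^ 2 := by rw [this, mul_one]
    rw [← add_div, ← neg_add, ← Complex.ofReal_add, h3]
    push_cast
    ring
  have hA'1 : ‖A'‖ ≤ 1 := by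
    have : -((n * (t * (c / n)) ^ 2 * v : ℝ) : ℂ) / 2
        = ((-(n * (t * (c / n)) ^ 2 * v / 2) : ℝ) : ℂ) := by push_cast; ring
    rw [hA', this, Complex.norm_exp_ofReal, Real.exp_le_one_iff, neg_nonpos]
    positivity
  have hB1 : ‖B‖ ≤ 1 := (norm_pow_le _ _).trans
    (pow_le_one₀ (norm_nonneg _) (norm_weightedCharFun_le hq hq1 g _))
  have hAB : A * B - A' * B' = (A - A') * B + A' * (B - B') := by ring
  rw [dist_eq_norm, hlim, hAB]
  calc ‖(A - A') * B + A' * (B - B')‖ ≤ ‖A - A'‖ * ‖B‖ + ‖A'‖ * ‖B - B'‖ :=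
        (norm_add_le _ _).trans (add_le_add (norm_mul_le _ _) (norm_mul_le _ _))
    _ ≤ ‖A - A'‖ * 1 + 1 * ‖B - B'‖ := by gcongr
    _ ≤ η * (n * (t * (c / n)) ^ 2) + η * (m * (t * (c / m)) ^ 2) := by
        rw [mul_one, one_mul]; exact add_le_add e₁ e₂
    _ = η * (t ^ 2 * (n * (c / n) ^ 2)) + η * (t ^ 2 * (m * (c / m) ^ 2)) := by ring
    _ ≤ η * (t ^ 2 * (1 / v)) + η * (t ^ 2 * (1 / w)) := by gcongr
    _ < ε := hηε

/-- Characteristic functions of two random variables that are close in probability are close. -/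
theorem norm_integral_exp_sub_le {Ω : Type*} [MeasurableSpace Ω] {ν : Measure Ω}
    [IsProbabilityMeasure ν] {X Y : Ω → ℝ} (hX : Measurable X) (hY : Measurable Y) (t : ℝ)
    {ε : ℝ} (hε : 0 ≤ ε) :
    ‖∫ ω, Complex.exp ((t * X ω : ℝ) * Complex.I) ∂ν
      - ∫ ω, Complex.exp ((t * Y ω : ℝ) * Complex.I) ∂ν‖
      ≤ |t| * ε + 2 * ν.real {ω | ε < |X ω - Y ω|} := by
  have hint : ∀ {X : Ω → ℝ}, Measurable X →
      Integrable (fun ω => Complex.exp ((t * X ω : ℝ) * Complex.I)) ν := fun hX =>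
    Integrable.of_bound (by fun_prop) 1
      (ae_of_all _ fun ω => (Complex.norm_exp_ofReal_mul_I _).le)
  have hB : MeasurableSet {ω | ε < |X ω - Y ω|} :=
    measurableSet_lt measurable_const (by fun_prop)
  rw [← integral_sub (hint hX) (hint hY)]
  refine (norm_integral_le_integral_norm _).trans ?_
  have hle : ∀ ω, ‖Complex.exp ((t * X ω : ℝ) * Complex.I)
      - Complex.exp ((t * Y ω : ℝ) * Complex.I)‖ ≤
      |t| * ε + Set.indicator {ω | ε < |X ω - Y ω|} (fun _ => (2 : ℝ)) ω := by
    intro ω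
    by_cases h : ω ∈ {ω | ε < |X ω - Y ω|}
    · rw [Set.indicator_of_mem h]
      refine (norm_sub_le _ _).trans ?_
      rw [Complex.norm_exp_ofReal_mul_I, Complex.norm_exp_ofReal_mul_I]
      have : 0 ≤ |t| * ε := by positivity
      linarith
    · rw [Set.indicator_of_notMem h, add_zero]
      have h' : |X ω - Y ω| ≤ ε := not_lt.1 h
      have heq : Complex.exp ((t * X ω : ℝ) * Complex.I)
          - Complex.exp ((t * Y ω : ℝ) * Complex.I) =
          Complex.exp ((t * Y ω : ℝ) * Complex.I) *
            (Complex.exp (Complex.I * (t * (X ω - Y ω) : ℝ)) - 1) := by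
        rw [mul_sub, ← Complex.exp_add]
        push_cast
        ring_nf
      rw [heq, norm_mul, Complex.norm_exp_ofReal_mul_I, one_mul]
      refine Real.norm_exp_I_mul_ofReal_sub_one_le.trans ?_
      rw [Real.norm_eq_abs, abs_mul]
      gcongr
  refine (integral_mono ((hint hX).sub (hint hY)).norm
    ((integrable_const _).add ((integrable_const _).indicator hB)) hle).trans_eq ?_
  rw [integral_add' (integrable_const _) ((integrable_const _).indicator hB),
    integral_indicator hB, setIntegral_const, integral_const]
  simp [mul_comm]

section Conditional

variable {r : ℕ} {P : Measure (Fin r × Fin 2)} [IsProbabilityMeasure P]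
  {Ω : Type*} [MeasurableSpace Ω] {μ : Measure Ω}
  {Z : ℕ → Ω → Fin r × Fin 2}

theorem measurable_comp_finite (hZ_meas : ∀ i, Measurable (Z i)) (N : ℕ)
    (g : (Fin N → Fin r × Fin 2) → ℝ) : Measurable fun ω => g fun i => Z i ω :=
  (measurable_of_countable g).comp (measurable_pi_lambda _ fun i => hZ_meas i)

theorem measurable_binCount (hZ_meas : ∀ i, Measurable (Z i)) (N : ℕ) (y : Fin 2) (j : Fin r) :
    Measurable fun ω => (binCount (fun i => Z i ω) N y j : ℝ) := by
  simpa only [binCount, Finset.sum_range] using measurable_comp_finite hZ_meas N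
    fun z => ((∑ i : Fin N, if z i = (j, y) then 1 else 0 : ℕ) : ℝ)

theorem measurable_empBin (hZ_meas : ∀ i, Measurable (Z i)) (N : ℕ) (y : Fin 2) (j : Fin r) :
    Measurable fun ω => empBin (fun i => Z i ω) N y j :=
  (measurable_binCount hZ_meas N y j).div
    (measurable_from_top.comp (measurable_labelCount hZ_meas N y))

theorem measurable_normError (hZ_meas : ∀ i, Measurable (Z i)) (p q : Fin r → ℝ) (N : ℕ) :
    Measurable fun ω => normError p q (fun i => Z i ω) N := by
  have h1 : ∀ y, Measurable fun ω => (labelCount (fun i => Z i ω) N y : ℝ) := fun y =>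
    measurable_from_top.comp (measurable_labelCount hZ_meas N y)
  have h2 := measurable_empBin hZ_meas N
  simp only [normError, jeffreys]
  fun_prop

theorem measurable_linearError (hZ_meas : ∀ i, Measurable (Z i)) (p q : Fin r → ℝ) (n m : ℕ) :
    Measurable fun ω => linearError p q (fun i => Z i ω) n m := by
  have h2 := measurable_empBin hZ_meas (n + m)
  unfold linearError
  fun_prop

variable [IsProbabilityMeasure μ]

/-- Given the class sizes, the linearized error is a sum over the observations, so its characteristic
function is a product of powers of two characteristic functions of a single observation. -/
theorem integral_cond_exp_linearError (hZ_meas : ∀ i, Measurable (Z i))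
    (hZ_indep : iIndepFun Z μ) (hZ_law : ∀ i, μ.map (Z i) = P)
    (h1 : 0 < P.real {z | z.2 = 1}) (h0 : 0 < P.real {z | z.2 = 0}) {n m : ℕ}
    (hn : 0 < n) (hm : 0 < m) (t : ℝ) :
    ∫ ω, Complex.exp ((t * linearError (condBin P 1) (condBin P 0) (fun i => Z i ω) n m : ℝ)
        * Complex.I)
      ∂(ProbabilityTheory.cond μ {ω | labelCount (fun i => Z i ω) (n + m) 1 = n}) =
    weightedCharFun (condBin P 1)
      (centered (condBin P 1) fun j => jeffreysSlope (condBin P 1 j) (condBin P 0 j))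
      (t * (errorScale (V₁ (condBin P 1) (condBin P 0)) (V₂ (condBin P 1) (condBin P 0)) n m / n))
        ^ n *
    weightedCharFun (condBin P 0)
      (centered (condBin P 0) fun j => jeffreysSlope (condBin P 0 j) (condBin P 1 j))
      (t * (errorScale (V₁ (condBin P 1) (condBin P 0)) (V₂ (condBin P 1) (condBin P 0)) n m / m))
        ^ m := by
  set p := condBin P 1
  set q := condBin P 0
  set c := errorScale (V₁ p q) (V₂ p q) n m with hc
  set f := centered p fun j => jeffreysSlope (p j) (q j)
  set g := centered q fun j => jeffreysSlope (q j) (p j)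
  set h : Fin r × Fin 2 → ℂ := fun z => if z.2 = 1
    then Complex.exp ((t * (c / n) * f z.1 : ℝ) * Complex.I)
    else Complex.exp ((t * (c / m) * g z.1 : ℝ) * Complex.I) with hh
  have hpt : ∀ᵐ ω ∂(ProbabilityTheory.cond μ {ω | labelCount (fun i => Z i ω) (n + m) 1 = n}),
      Complex.exp ((t * linearError p q (fun i => Z i ω) n m : ℝ) * Complex.I) =
        ∏ i ∈ Finset.range (n + m), h (Z i ω) := by
    filter_upwards [ae_cond_labelCount hZ_meas n m] with ω hω
    have hL : t * linearError p q (fun i => Z i ω) n m = ∑ i ∈ Finset.range (n + m),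
        if (Z i ω).2 = 1 then t * (c / n) * f (Z i ω).1 else t * (c / m) * g (Z i ω).1 := by
      rw [linearError, sum_mul_empBin_sub (s := n) (by simpa using hω 1) hn,
        sum_mul_empBin_sub (s := m) (by simpa using hω 0) hm, ← hc, ← mul_assoc, mul_add,
        ← mul_div_assoc, ← mul_div_assoc, mul_div_right_comm, mul_div_right_comm (t * c),
        Finset.mul_sum, Finset.mul_sum, ← Finset.sum_add_distrib]
      refine Finset.sum_congr rfl fun i _ => ?_
      rcases (show (Z i ω).2 = 0 ∨ (Z i ω).2 = 1 by
        generalize (Z i ω).2 = y; fin_cases y <;> simp) with hy | hy <;>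
        simp [hy, f, g, mul_div_assoc]
    rw [hL, Complex.ofReal_sum, Finset.sum_mul, Complex.exp_sum]
    refine Finset.prod_congr rfl fun i _ => ?_
    simp only [hh]
    split_ifs <;> rfl
  rw [integral_congr_ae hpt, integral_cond_prod hZ_meas hZ_indep hZ_law h1 h0]
  simp [weightedCharFun, hh, p, q]

/-- Given the class sizes, the normalized error and its first-order approximation are close in
probability. -/
theorem eventually_measureReal_cond_normError_sub_le (hZ_meas : ∀ i, Measurable (Z i))
    (hZ_indep : iIndepFun Z μ) (hZ_law : ∀ i, μ.map (Z i) = P)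
    (hp : ∀ j, 0 < condBin P 1 j) (hq : ∀ j, 0 < condBin P 0 j)
    (h1 : 0 < P.real {z | z.2 = 1}) (h0 : 0 < P.real {z | z.2 = 0})
    (hV₁ : 0 < V₁ (condBin P 1) (condBin P 0)) (hV₂ : 0 < V₂ (condBin P 1) (condBin P 0))
    {ε κ : ℝ} (hε : 0 < ε) (hκ : 0 < κ) :
    ∀ᶠ k : ℕ × ℕ in atTop ×ˢ atTop,
      (ProbabilityTheory.cond μ {ω | labelCount (fun i => Z i ω) (k.1 + k.2) 1 = k.1}).real
        {ω | ε < |normError (condBin P 1) (condBin P 0) (fun i => Z i ω) (k.1 + k.2)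
          - linearError (condBin P 1) (condBin P 0) (fun i => Z i ω) k.1 k.2|} ≤ κ := by
  set p := condBin P 1 with hpdef
  set q := condBin P 0 with hqdef
  set b := max √(1 / V₁ p q) √(1 / V₂ p q) with hb
  have hb0 : 0 ≤ b := le_max_of_le_left (Real.sqrt_nonneg _)
  -- `K` is so large that all frequencies are within `K / √s` outside an event of probability `κ`.
  obtain ⟨K, hK0, hK⟩ : ∃ K : ℝ, 0 < K ∧ 2 * (r * (2 * Real.exp (1 - K))) ≤ κ := by
    have ht : Tendsto (fun K : ℝ => 2 * (r * (2 * Real.exp (1 - K)))) atTop (𝓝 0) := by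
      have h := (Real.tendsto_exp_neg_atTop_nhds_zero.const_mul (2 * (r * (2 * Real.exp 1))))
      rw [mul_zero] at h
      refine h.congr fun K => ?_
      rw [sub_eq_add_neg, Real.exp_add]
      ring
    obtain ⟨K, h, h'⟩ := ((eventually_gt_atTop 0).and (ht.eventually (gt_mem_nhds hκ))).exists
    exact ⟨K, h, h'.le⟩
  -- The error scale is at most `b √s` for both class sizes `s`, so that the remainder is at most
  -- `r η K b` on the good event.
  set η := ε / (r * K * b + 1) with hη
  have hη0 : 0 < η := by positivity
  have hηε : r * (η * (K * b)) ≤ ε := by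
    have : r * (η * (K * b)) = ε * (r * K * b) / (r * K * b + 1) := by rw [hη]; ring
    rw [this, div_le_iff₀ (by positivity)]
    nlinarith
  obtain ⟨δ, hδ, hrem⟩ := exists_jeffreys_sub_le hp hq hη0
  filter_upwards [prod_mem_prod
    ((eventually_gt_atTop 0).and (eventually_div_sqrt_lt K hδ))
    ((eventually_gt_atTop 0).and (eventually_div_sqrt_lt K hδ))] with k hk
  obtain ⟨⟨hn, hn'⟩, ⟨hm, hm'⟩⟩ := hk
  set n := k.1
  set m := k.2
  have hνp := isProbabilityMeasure_cond_labelCount hZ_meas hZ_indep hZ_law h1 h0 n m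
  set ν := ProbabilityTheory.cond μ {ω | labelCount (fun i => Z i ω) (n + m) 1 = n} with hν
  have hpos : ∀ y, 0 < (![m, n] y : ℕ) := by
    intro y; fin_cases y; exacts [hm, hn]
  set bad : Fin 2 → Fin r → Set Ω := fun y j =>
    {ω | K ≤ √(![m, n] y : ℕ) * |empBin (fun i => Z i ω) (n + m) y j - condBin P y j|} with hbad
  have hsub : {ω | ε < |normError p q (fun i => Z i ω) (n + m)
      - linearError p q (fun i => Z i ω) n m|} ≤ᵐ[ν] (⋃ y, ⋃ j, bad y j : Set Ω) := by
    filter_upwards [ae_cond_labelCount hZ_meas n m] with ω hω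
    intro hlt
    by_contra hgood
    have hgood' : ∀ y j, |empBin (fun i => Z i ω) (n + m) y j - condBin P y j|
        ≤ K / √(![m, n] y : ℕ) := by
      intro y j
      have h3 : ω ∉ bad y j := fun h3 => hgood (Set.mem_iUnion.2 ⟨y, Set.mem_iUnion.2 ⟨j, h3⟩⟩)
      have h4 : 0 < √((![m, n] y : ℕ) : ℝ) := Real.sqrt_pos.2 (by exact_mod_cast hpos y)
      rw [le_div_iff₀' h4]
      exact (not_le.1 h3).le
    refine not_lt.2 ?_ hlt
    have hr := hrem _ _ (K / √n) (K / √m) hn' hm' (hgood' 1) (hgood' 0)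
    have hN1 : labelCount (fun i => Z i ω) (n + m) 1 = n := by simpa using hω 1
    have hN0 : labelCount (fun i => Z i ω) (n + m) 0 = m := by simpa using hω 0
    have hdiff : normError p q (fun i => Z i ω) (n + m) - linearError p q (fun i => Z i ω) n m =
        errorScale (V₁ p q) (V₂ p q) n m *
          (jeffreys (empBin (fun i => Z i ω) (n + m) 1) (empBin (fun i => Z i ω) (n + m) 0)
            - jeffreys p q
            - (∑ j, jeffreysSlope (p j) (q j) * (empBin (fun i => Z i ω) (n + m) 1 j - p j)
              + ∑ j, jeffreysSlope (q j) (p j) *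
                (empBin (fun i => Z i ω) (n + m) 0 j - q j))) := by
      rw [normError, linearError]
      simp only [hN1, hN0]
      rw [errorScale]
      ring
    have hc0 := errorScale_nonneg (v := V₁ p q) (w := V₂ p q) (n := n) (m := m)
    have hL := div_sqrt_le_of_mul_div_sq_le hn (errorScale_sq_left_le hV₁ hV₂ hn hm)
    have hR := div_sqrt_le_of_mul_div_sq_le hm (errorScale_sq_right_le hV₁ hV₂ hn hm)
    set c := errorScale (V₁ p q) (V₂ p q) n m
    rw [hdiff, abs_mul, abs_of_nonneg hc0]
    refine (mul_le_mul_of_nonneg_left hr hc0).trans (le_trans ?_ hηε)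
    have hmax : c * max (K / √n) (K / √m) ≤ K * b := by
      rw [mul_max_of_nonneg _ _ hc0]
      refine max_le ?_ ?_
      · calc c * (K / √n) = K * (c / √n) := by ring
          _ ≤ K * b := by gcongr; exact hL.trans (le_max_left _ _)
      · calc c * (K / √m) = K * (c / √m) := by ring
          _ ≤ K * b := by gcongr; exact hR.trans (le_max_right _ _)
    calc c * (r * (η * max (K / √n) (K / √m))) = r * (η * (c * max (K / √n) (K / √m))) := by ring
      _ ≤ _ := by gcongr
  calc ν.real _ ≤ ν.real (⋃ y, ⋃ j, bad y j) :=
        ENNReal.toReal_mono (measure_ne_top _ _) (measure_mono_ae hsub)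
    _ ≤ ∑ y, ∑ j, ν.real (bad y j) :=
        (measureReal_iUnion_fintype_le _).trans
          (Finset.sum_le_sum fun y _ => measureReal_iUnion_fintype_le _)
    _ ≤ ∑ _y : Fin 2, ∑ _j : Fin r, 2 * Real.exp (1 - K) :=
        Finset.sum_le_sum fun y _ => Finset.sum_le_sum fun j _ =>
          measureReal_cond_empBin_le hZ_meas hZ_indep hZ_law h1 h0 n m y (hpos y) j K
    _ = 2 * (r * (2 * Real.exp (1 - K))) := by simp
    _ ≤ κ := hK

end Conditional

/-! ### Convergence in distribution -/

theorem tendstoInDistribution_gaussian_of_tendsto_integral_exp {ι : Type*} {l : Filter ι}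
    [l.IsCountablyGenerated] {Ω : Type*} [MeasurableSpace Ω] {ν : ι → Measure Ω}
    [∀ i, IsProbabilityMeasure (ν i)] {X : ι → Ω → ℝ} (hX : ∀ i, Measurable (X i))
    (h : ∀ t : ℝ, Tendsto (fun i => ∫ ω, Complex.exp ((t * X i ω : ℝ) * Complex.I) ∂(ν i)) l
      (𝓝 (Complex.exp (-(t : ℂ) ^ 2 / 2)))) :
    TendstoInDistribution X l (id : ℝ → ℝ) ν (gaussianReal 0 1) where
  forall_aemeasurable i := (hX i).aemeasurable
  aemeasurable_limit := aemeasurable_id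
  tendsto := by
    refine tendsto_of_seq_tendsto fun u hu => ?_
    refine ProbabilityMeasure.tendsto_iff_tendsto_charFun.2 fun t => ?_
    have hlim : charFun ((gaussianReal 0 1).map id) t = Complex.exp (-(t : ℂ) ^ 2 / 2) := by
      rw [Measure.map_id, charFun_gaussianReal]
      congr 1
      simp
      ring
    have hchar : ∀ i, charFun ((ν i).map (X i)) t =
        ∫ ω, Complex.exp ((t * X i ω : ℝ) * Complex.I) ∂(ν i) := fun i => by
      rw [charFun_apply_real, integral_map (hX i).aemeasurable (by fun_prop)]
      simp only [Complex.ofReal_mul]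
    simp only [ProbabilityMeasure.coe_mk, hlim]
    exact ((h t).comp hu).congr fun n => (hchar (u n)).symm

section Main

variable {r : ℕ} {P : Measure (Fin r × Fin 2)} [IsProbabilityMeasure P]
  {Ω : Type*} [MeasurableSpace Ω] {μ : Measure Ω} [IsProbabilityMeasure μ]
  {Z : ℕ → Ω → Fin r × Fin 2}

theorem tendsto_integral_cond_exp_normError (hZ_meas : ∀ i, Measurable (Z i))
    (hZ_indep : iIndepFun Z μ) (hZ_law : ∀ i, μ.map (Z i) = P)
    (hp : ∀ j, 0 < condBin P 1 j) (hq : ∀ j, 0 < condBin P 0 j)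
    (h1 : 0 < P.real {z | z.2 = 1}) (h0 : 0 < P.real {z | z.2 = 0})
    (hpq : condBin P 1 ≠ condBin P 0) (t : ℝ) :
    Tendsto (fun k : ℕ × ℕ => ∫ ω, Complex.exp
        ((t * normError (condBin P 1) (condBin P 0) (fun i => Z i ω) (k.1 + k.2) : ℝ) * Complex.I)
        ∂(ProbabilityTheory.cond μ {ω | labelCount (fun i => Z i ω) (k.1 + k.2) 1 = k.1}))
      (atTop ×ˢ atTop) (𝓝 (Complex.exp (-(t : ℂ) ^ 2 / 2))) := by
  have hp1 := sum_condBin h1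
  have hq1 := sum_condBin h0
  have hV₁ := V₁_pos hp hq hp1 hq1 hpq
  -- `V₂ p q` is by definition `V₁ q p`.
  have hV₂ : 0 < V₂ (condBin P 1) (condBin P 0) := V₁_pos hq hp hq1 hp1 hpq.symm
  have hV₁' := V₁_eq_variance hp1 (condBin P 0)
  have hV₂' : V₂ (condBin P 1) (condBin P 0) = _ := V₁_eq_variance hq1 (condBin P 1)
  have hlin : Tendsto (fun k : ℕ × ℕ => ∫ ω, Complex.exp
        ((t * linearError (condBin P 1) (condBin P 0) (fun i => Z i ω) k.1 k.2 : ℝ) * Complex.I)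
        ∂(ProbabilityTheory.cond μ {ω | labelCount (fun i => Z i ω) (k.1 + k.2) 1 = k.1}))
      (atTop ×ˢ atTop) (𝓝 (Complex.exp (-(t : ℂ) ^ 2 / 2))) := by
    refine (tendsto_weightedCharFun_pow_mul (fun j => (hp j).le) (fun j => (hq j).le) hp1 hq1
      (sum_mul_centered hp1 fun j => jeffreysSlope (condBin P 1 j) (condBin P 0 j))
      (sum_mul_centered hq1 fun j => jeffreysSlope (condBin P 0 j) (condBin P 1 j))
      (hV₁'.symm ▸ hV₁) (hV₂'.symm ▸ hV₂) t).congr' ?_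
    filter_upwards [prod_mem_prod (eventually_gt_atTop 0) (eventually_gt_atTop 0)] with k hk
    rw [integral_cond_exp_linearError hZ_meas hZ_indep hZ_law h1 h0 hk.1 hk.2, hV₁', hV₂']
    rfl
  have hdiff : Tendsto (fun k : ℕ × ℕ => ∫ ω, Complex.exp
        ((t * normError (condBin P 1) (condBin P 0) (fun i => Z i ω) (k.1 + k.2) : ℝ) * Complex.I)
        ∂(ProbabilityTheory.cond μ {ω | labelCount (fun i => Z i ω) (k.1 + k.2) 1 = k.1})
      - ∫ ω, Complex.exp
        ((t * linearError (condBin P 1) (condBin P 0) (fun i => Z i ω) k.1 k.2 : ℝ) * Complex.I)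
        ∂(ProbabilityTheory.cond μ {ω | labelCount (fun i => Z i ω) (k.1 + k.2) 1 = k.1}))
      (atTop ×ˢ atTop) (𝓝 0) := by
    rw [Metric.tendsto_nhds]
    intro ε hε
    have hε' : 0 < ε / (2 * (|t| + 1)) := by positivity
    filter_upwards [eventually_measureReal_cond_normError_sub_le hZ_meas hZ_indep hZ_law hp hq h1 h0
      hV₁ hV₂ hε' (show 0 < ε / 8 by positivity)] with k hk
    have := isProbabilityMeasure_cond_labelCount hZ_meas hZ_indep hZ_law h1 h0 k.1 k.2
    rw [dist_zero_right]
    refine (norm_integral_exp_sub_le (measurable_normError hZ_meas _ _ _)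
      (measurable_linearError hZ_meas _ _ _ _) t hε'.le).trans_lt ?_
    have h3 : |t| * (ε / (2 * (|t| + 1))) ≤ ε / 2 := by
      rw [mul_div_assoc', div_le_div_iff₀ (by positivity) two_pos]
      nlinarith [abs_nonneg t]
    linarith
  simpa using hdiff.add hlin

/-- Both classes become large: the exponential moment of minus a label count is a geometric
sequence of ratio less than `1`. -/
theorem tendsto_measureReal_labelCount_lt (hZ_meas : ∀ i, Measurable (Z i))
    (hZ_indep : iIndepFun Z μ) (hZ_law : ∀ i, μ.map (Z i) = P) {y : Fin 2}
    (hy : 0 < P.real {z | z.2 = y}) (n₀ : ℕ) :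
    Tendsto (fun N => μ.real {ω | labelCount (fun i => Z i ω) N y < n₀}) atTop (𝓝 0) := by
  set w := P.real {z | z.2 = y} with hw
  set ρ := 1 + w * (Real.exp (-1) - 1) with hρ
  have hw1 : w ≤ 1 := measureReal_le_one
  have he1 : Real.exp (-1) < 1 := by rw [← Real.exp_zero]; exact Real.exp_lt_exp.2 (by norm_num)
  have hρ0 : 0 ≤ ρ := by nlinarith [Real.exp_pos (-1)]
  have hρ1 : ρ < 1 := by nlinarith
  have hpt : ∀ N ω, Real.exp (-(labelCount (fun i => Z i ω) N y : ℝ)) =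
      ∏ i ∈ Finset.range N, (1 + if (Z i ω).2 = y then Real.exp (-1) - 1 else 0) := by
    intro N ω
    rw [labelCount_eq_card, Finset.card_filter]
    push_cast
    rw [← Finset.sum_neg_distrib, Real.exp_sum]
    exact Finset.prod_congr rfl fun i _ => by split_ifs <;> simp
  have hint : ∀ N, Integrable (fun ω => Real.exp (-(labelCount (fun i => Z i ω) N y : ℝ))) μ := by
    intro N
    refine (integrable_comp_finite hZ_meas N (fun z => ∏ i : Fin N,
      (1 + if (z i).2 = y then Real.exp (-1) - 1 else 0))).congr (ae_of_all _ fun ω => ?_)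
    simp only [hpt, Finset.prod_range]
  have hmom : ∀ N, ∫ ω, Real.exp (-(labelCount (fun i => Z i ω) N y : ℝ)) ∂μ = ρ ^ N := by
    intro N
    have hone : ∀ i, ∫ ω, (1 + if (Z i ω).2 = y then Real.exp (-1) - 1 else 0) ∂μ = ρ := by
      intro i
      have hm : Integrable (fun ω => if (Z i ω).2 = y then Real.exp (-1) - 1 else 0) μ := by
        refine Integrable.of_bound ((measurable_of_countable fun z : Fin r × Fin 2 =>
          if z.2 = y then Real.exp (-1) - 1 else 0).comp
            (hZ_meas i)).aestronglyMeasurable |Real.exp (-1) - 1| (ae_of_all _ fun ω => ?_)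
        split_ifs <;> simp
      rw [integral_add (integrable_const _) hm,
        integral_comp_label (𝕜 := ℝ) hZ_meas hZ_law (fun _ => Real.exp (-1) - 1), ← Finset.sum_mul]
      have := sum_condBin hy
      simp [this, hρ, hw]
    simp only [hpt]
    rw [integral_prod_range hZ_meas hZ_indep N
      (fun _ z => 1 + if z.2 = y then Real.exp (-1) - 1 else 0), Finset.prod_congr rfl
      fun i _ => hone i, Finset.prod_const, Finset.card_range]
  have hbound : ∀ N, μ.real {ω | labelCount (fun i => Z i ω) N y < n₀}
      ≤ Real.exp n₀ * ρ ^ N := by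
    intro N
    have h := mul_meas_ge_le_integral_of_nonneg (ae_of_all μ fun ω => (Real.exp_pos
      (-(labelCount (fun i => Z i ω) N y : ℝ))).le) (hint N) (Real.exp (-(n₀ : ℝ)))
    rw [hmom] at h
    calc _ ≤ μ.real {ω | Real.exp (-(n₀ : ℝ)) ≤
          Real.exp (-(labelCount (fun i => Z i ω) N y : ℝ))} := by
          refine measureReal_mono fun ω hω => ?_
          have hω' : labelCount (fun i => Z i ω) N y < n₀ := hω
          simp only [Set.mem_ofPred_eq, Real.exp_le_exp, neg_le_neg_iff, Nat.cast_le]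
          exact hω'.le
      _ = Real.exp n₀ * (Real.exp (-(n₀ : ℝ)) * μ.real {ω | Real.exp (-(n₀ : ℝ)) ≤
          Real.exp (-(labelCount (fun i => Z i ω) N y : ℝ))}) := by
          rw [← mul_assoc, ← Real.exp_add, add_neg_cancel, Real.exp_zero, one_mul]
      _ ≤ _ := by gcongr
  have hlim : Tendsto (fun N => Real.exp n₀ * ρ ^ N) atTop (𝓝 0) := by
    simpa using (tendsto_pow_atTop_nhds_zero_of_lt_one hρ0 hρ1).const_mul (Real.exp n₀)
  exact squeeze_zero (fun N => measureReal_nonneg) hbound hlim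

theorem norm_integral_cond_le_one {F : Ω → ℂ} (hF1 : ∀ ω, ‖F ω‖ ≤ 1) (E : Set Ω) :
    ‖∫ ω, F ω ∂(ProbabilityTheory.cond μ E)‖ ≤ 1 := by
  refine (norm_integral_le_of_norm_le_const (ae_of_all _ hF1)).trans ?_
  rw [one_mul]
  by_cases h : μ E = 0
  · simp [cond_eq_zero_of_meas_eq_zero h]
  · have := cond_isProbabilityMeasure h
    exact measureReal_le_one

/-- The tower property for conditioning on the label count. -/
theorem integral_eq_integral_cond_labelCount (hZ_meas : ∀ i, Measurable (Z i)) (N : ℕ)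
    {F : Ω → ℂ} (hF : Measurable F) (hF1 : ∀ ω, ‖F ω‖ ≤ 1) :
    ∫ ω, F ω ∂μ = ∫ ω, (fun n : ℕ => ∫ ω', F ω' ∂(ProbabilityTheory.cond μ
      {ω' | labelCount (fun i => Z i ω') N 1 = n})) (labelCount (fun i => Z i ω) N 1) ∂μ := by
  set E : ℕ → Set Ω := fun n => {ω | labelCount (fun i => Z i ω) N 1 = n} with hE
  set φ : ℕ → ℂ := fun n => ∫ ω', F ω' ∂(ProbabilityTheory.cond μ (E n)) with hφ
  have hEm : ∀ n, MeasurableSet (E n) := fun n => measurableSet_labelCount_eq hZ_meas N n 1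
  have hsplit : ∀ G : Ω → ℂ, Integrable G μ →
      ∫ ω, G ω ∂μ = ∑ n ∈ Finset.range (N + 1), ∫ ω in E n, G ω ∂μ := by
    intro G hG
    rw [← integral_biUnion_finset _ (fun n _ => hEm n) _ (fun n _ => hG.integrableOn),
      ← setIntegral_univ]
    · congr 2
      refine (Set.eq_univ_of_forall fun ω => ?_).symm
      have := labelCount_add (fun i => Z i ω) N
      simp only [Set.mem_iUnion, hE]
      exact ⟨_, Finset.mem_range.2 (by omega), rfl⟩
    · intro a _ b _ hab
      exact Set.disjoint_left.2 fun ω ha hb => hab (ha.symm.trans hb)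
  have hφ1 : ∀ n, ‖φ n‖ ≤ 1 := fun n => norm_integral_cond_le_one hF1 (E n)
  have hmeas := measurable_labelCount hZ_meas N 1
  rw [hsplit F (.of_bound hF.aestronglyMeasurable 1 (ae_of_all _ hF1)),
    hsplit (fun ω => φ (labelCount (fun i => Z i ω) N 1))
      (.of_bound ((measurable_of_countable φ).comp hmeas).aestronglyMeasurable 1
        (ae_of_all _ fun ω => hφ1 _))]
  refine Finset.sum_congr rfl fun n _ => ?_
  rw [setIntegral_congr_fun (g := fun _ => φ n) (hEm n)
    (fun ω hω => congrArg φ (show labelCount (fun i => Z i ω) N 1 = n from hω)),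
    setIntegral_const, hφ]
  simp only [ProbabilityTheory.cond, integral_smul_measure]
  rcases eq_or_ne (μ (E n)) 0 with h | h
  · simp [Measure.restrict_eq_zero.2 h]
  · rw [smul_smul, ENNReal.toReal_inv, ← measureReal_def, mul_inv_cancel₀, one_smul]
    exact (measureReal_ne_zero_iff (measure_ne_top _ _)).2 h

/-- The law of the normalized error is the mixture of its conditional laws given the class sizes,
which are both large with probability close to `1`. -/
theorem tendsto_integral_exp_normError (hZ_meas : ∀ i, Measurable (Z i))
    (hZ_indep : iIndepFun Z μ) (hZ_law : ∀ i, μ.map (Z i) = P)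
    (hp : ∀ j, 0 < condBin P 1 j) (hq : ∀ j, 0 < condBin P 0 j)
    (h1 : 0 < P.real {z | z.2 = 1}) (h0 : 0 < P.real {z | z.2 = 0})
    (hpq : condBin P 1 ≠ condBin P 0) (t : ℝ) :
    Tendsto (fun N : ℕ => ∫ ω, Complex.exp
        ((t * normError (condBin P 1) (condBin P 0) (fun i => Z i ω) N : ℝ) * Complex.I) ∂μ)
      atTop (𝓝 (Complex.exp (-(t : ℂ) ^ 2 / 2))) := by
  have hcond := tendsto_integral_cond_exp_normError hZ_meas hZ_indep hZ_law hp hq h1 h0 hpq t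
  set L := Complex.exp (-(t : ℂ) ^ 2 / 2) with hL
  have hL1 : ‖L‖ ≤ 1 := by
    have : -(t : ℂ) ^ 2 / 2 = ((-(t ^ 2 / 2) : ℝ) : ℂ) := by push_cast; ring
    rw [hL, this, Complex.norm_exp_ofReal, Real.exp_le_one_iff, neg_nonpos]
    positivity
  rw [Metric.tendsto_nhds] at hcond ⊢
  intro ε hε
  have hk := hcond (ε / 2) (by positivity)
  rw [prod_atTop_atTop_eq, eventually_atTop] at hk
  obtain ⟨k₀, hk₀⟩ := hk
  have hbad := ((tendsto_measureReal_labelCount_lt hZ_meas hZ_indep hZ_law h1 k₀.1).eventually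
    (gt_mem_nhds (show 0 < ε / 8 by positivity))).and
    ((tendsto_measureReal_labelCount_lt hZ_meas hZ_indep hZ_law h0 k₀.2).eventually
    (gt_mem_nhds (show 0 < ε / 8 by positivity)))
  filter_upwards [hbad] with N hN
  set F : Ω → ℂ := fun ω => Complex.exp
    ((t * normError (condBin P 1) (condBin P 0) (fun i => Z i ω) N : ℝ) * Complex.I) with hF
  have hFm : Measurable F := by
    have := measurable_normError hZ_meas (condBin P 1) (condBin P 0) N
    fun_prop
  have hF1 : ∀ ω, ‖F ω‖ ≤ 1 := fun ω => (Complex.norm_exp_ofReal_mul_I _).le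
  set X : Ω → ℕ := fun ω => labelCount (fun i => Z i ω) N 1 with hX
  have hXm : Measurable X := measurable_labelCount hZ_meas N 1
  set φ : ℕ → ℂ := fun n => ∫ ω, F ω ∂(ProbabilityTheory.cond μ {ω | X ω = n}) with hφ
  have htower : ∫ ω, F ω ∂μ = ∫ ω, φ (X ω) ∂μ :=
    integral_eq_integral_cond_labelCount hZ_meas N hFm hF1
  have hφ1 : ∀ n, ‖φ n‖ ≤ 1 := fun n => norm_integral_cond_le_one hF1 _
  set B : Set Ω := {ω | labelCount (fun i => Z i ω) N 1 < k₀.1} ∪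
    {ω | labelCount (fun i => Z i ω) N 0 < k₀.2} with hB
  have hBm : MeasurableSet B :=
    (measurableSet_lt (measurable_labelCount hZ_meas N 1) measurable_const).union
      (measurableSet_lt (measurable_labelCount hZ_meas N 0) measurable_const)
  have hBr : μ.real B < ε / 4 := (measureReal_union_le _ _).trans_lt (by linarith [hN.1, hN.2])
  have hφi : Integrable (fun ω => φ (X ω)) μ :=
    .of_bound ((measurable_of_countable φ).comp hXm).aestronglyMeasurable 1
      (ae_of_all _ fun ω => hφ1 _)
  have hpt : ∀ ω, ‖φ (X ω) - L‖ ≤ ε / 2 + B.indicator (fun _ => (2 : ℝ)) ω := by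
    intro ω
    by_cases hω : ω ∈ B
    · rw [Set.indicator_of_mem hω]
      have := (norm_sub_le (φ (X ω)) L).trans (add_le_add (hφ1 _) hL1)
      linarith
    · rw [Set.indicator_of_notMem hω, add_zero]
      have hN' : X ω + labelCount (fun i => Z i ω) N 0 = N := labelCount_add _ N
      have hω' : ¬ X ω < k₀.1 ∧ ¬ labelCount (fun i => Z i ω) N 0 < k₀.2 := not_or.1 hω
      have h3 := hk₀ (X ω, labelCount (fun i => Z i ω) N 0)
        ⟨not_lt.1 hω'.1, not_lt.1 hω'.2⟩
      simp only [hN', dist_eq_norm] at h3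
      exact h3.le
  rw [htower, dist_eq_norm]
  have hLint : ∫ _ω, L ∂μ = L := by simp
  nth_rewrite 1 [← hLint]
  rw [← integral_sub hφi (integrable_const _)]
  refine (norm_integral_le_integral_norm _).trans_lt ?_
  calc ∫ ω, ‖φ (X ω) - L‖ ∂μ ≤ ∫ ω, (ε / 2 + B.indicator (fun _ => (2 : ℝ)) ω) ∂μ :=
        integral_mono (hφi.sub (integrable_const _)).norm
          ((integrable_const _).add ((integrable_const _).indicator hBm)) hpt
    _ = ε / 2 + 2 * μ.real B := by
        rw [integral_add (integrable_const _) ((integrable_const _).indicator hBm),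
          integral_indicator hBm, setIntegral_const, integral_const]
        simp [mul_comm]
    _ < ε := by linarith

end Main

theorem theorem2 {r : ℕ} (P : Measure (Fin r × Fin 2)) [IsProbabilityMeasure P]
    (p q : Fin r → ℝ) (hp : p = condBin P 1) (hq : q = condBin P 0)
    (hp_pos : ∀ j, 0 < p j) (hq_pos : ∀ j, 0 < q j) (hpq : p ≠ q)
    {Ω : Type*} [MeasurableSpace Ω] (μ : Measure Ω) [IsProbabilityMeasure μ]
    (Z : ℕ → Ω → Fin r × Fin 2) (hZ_meas : ∀ i, Measurable (Z i))
    (hZ_indep : iIndepFun Z μ) (hZ_law : ∀ i, μ.map (Z i) = P) :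
    -- the sample size tends to infinity, and the class sizes `n`, `m` are random
    TendstoInDistribution (fun (N : ℕ) (ω : Ω) => normError p q (fun i => Z i ω) N) atTop
      (id : ℝ → ℝ) (fun _ => μ) (gaussianReal 0 1) ∧
    -- the class sizes are given: conditionally on the event that exactly `n` of the first
    -- `n + m` labels are `1`, for `k = (n, m)` tending to `(∞, ∞)` in any way
    ∃ _ : ∀ k : ℕ × ℕ, IsProbabilityMeasure
        (ProbabilityTheory.cond μ {ω | labelCount (fun i => Z i ω) (k.1 + k.2) 1 = k.1}),
      TendstoInDistribution
        (fun (k : ℕ × ℕ) (ω : Ω) => normError p q (fun i => Z i ω) (k.1 + k.2))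
        (atTop ×ˢ atTop) (id : ℝ → ℝ)
        (fun k => ProbabilityTheory.cond μ
          {ω | labelCount (fun i => Z i ω) (k.1 + k.2) 1 = k.1})
        (gaussianReal 0 1) := by
  subst hp hq
  obtain ⟨j, -⟩ := Function.ne_iff.1 hpq
  have h1 := real_label_pos_of_condBin_pos (hp_pos j)
  have h0 := real_label_pos_of_condBin_pos (hq_pos j)
  have hprob := fun k : ℕ × ℕ =>
    isProbabilityMeasure_cond_labelCount hZ_meas hZ_indep hZ_law h1 h0 k.1 k.2
  exact ⟨tendstoInDistribution_gaussian_of_tendsto_integral_exp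
      (fun N => measurable_normError hZ_meas _ _ N)
      (tendsto_integral_exp_normError hZ_meas hZ_indep hZ_law hp_pos hq_pos h1 h0 hpq),
    hprob, tendstoInDistribution_gaussian_of_tendsto_integral_exp
      (fun k => measurable_normError hZ_meas _ _ _)
      (tendsto_integral_cond_exp_normError hZ_meas hZ_indep hZ_law hp_pos hq_pos h1 h0 hpq)⟩
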